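/- Let $V(x_1,x_2)=\tfrac12(x_1^2+x_2^2)+x_1^2x_2-\tfrac13x_2^3$ be the Hénon–Heiles potential and $H(x,y)=\tfrac12|y|^2+V(x)$ on $\mathbb R^4$, with Hamiltonian flow $\dot x=\partial_yH$, $\dot y=-\partial_xH$. Let $v_1=(0,1)$, $v_2=(-\tfrac{\sqrt3}{2},-\tfrac12)$, $v_3=(\tfrac{\sqrt3}{2},-\tfrac12)$ be the saddle points of $V$, let $K_{1/6}$ be the closed triangular region with vertices $v_1,v_2,v_3$, let $S_{1/6}=\{(x,y): H(x,y)=\tfrac16,\ x\in K_{1/6}\}$, and let $p_i=(v_i,0)$, $i=1,2,3$, be the saddle-centers in $S_{1/6}$. At a regular point of $H$ let $X_0=\nabla H/|\nabla H|$, $X_1=j_1X_0$, $X_2=j_2X_0$ (the quaternion frame), where $j_1(a_1,a_2,b_1,b_2)=(b_2,-b_1,a_2,-a_1)$ and $j_2(a_1,a_2,b_1,b_2)=(a_2,-a_1,-b_2,b_1)$. A transverse linearized solution along a trajectory $w(t)$ is $\alpha(t)=\langle u,X_1(w)\rangle+i\langle u,X_2(w)\rangle$, where $u(t)$ is a solution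 of the linearized Hamiltonian flow along $w$ tangent to the energy surface; $\theta(t)$ denotes a continuous argument of a non-vanishing $\alpha(t)$. For a periodic orbit $P=(w,T)$ ($w$ non-constant and $T>0$ any period of $w$), let $I$ be the set of all values $(\theta(T)-\theta(0))/2\pi$; the index $\mu(P)$ is $2k+1$ if $I-\varepsilon\subset(k,k+1)$, and $2k$ if $k\in\mathrm{int}(I-\varepsilon)$, $k\in\mathbb Z$, for all sufficiently small $\varepsilon>0$. Then: (i) $S_{1/6}\setminus\{p_1,p_2,p_3\}$ is dynamically convex: every periodic orbit $P$ contained in it has (well-defined) index $\mu(P)\ge 3$. (ii) The quaternion frame $\{X_1,X_2\}$ is positive on $S_{1/6}\setminus\{p_1,p_2,p_3\}$: it is defined and symplectic there, i.e. $\nabla H\neq0$ and $\omega_0(X_1,X_2)=1$ with $\omega_0=dy_1\wedge dx_1+dy_2\wedge dx_2$, and along every trajectory in this set every continuous argument $\theta$ of a non-vanishing transverse linearized solution satisfies $\dot\theta(t)>0$ for all $t$. -/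

import Mathlib

open Set Filter Topology

noncomputable section

namespace HenonHeiles

/-- The plane `ℝ²` of positions. -/
abbrev R2 : Type := EuclideanSpace ℝ (Fin 2)

/-- Phase space `ℝ⁴` with coordinates `(x₁, x₂, y₁, y₂) = (w 0, w 1, w 2, w 3)`. -/
abbrev R4 : Type := EuclideanSpace ℝ (Fin 4)

/-- The standard symplectic form `ω₀ = dy₁ ∧ dx₁ + dy₂ ∧ dx₂`. -/
def omega0 (u v : R4) : ℝ :=
  (u 2 * v 0 - u 0 * v 2) + (u 3 * v 1 - u 1 * v 3)

/-- `j₁ (a₁, a₂, b₁, b₂) = (b₂, -b₁, a₂, -a₁)`. -/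
def j1 (v : R4) : R4 := !₂[v 3, -v 2, v 1, -v 0]

/-- `j₂ (a₁, a₂, b₁, b₂) = (a₂, -a₁, -b₂, b₁)`. -/
def j2 (v : R4) : R4 := !₂[v 1, -v 0, -v 3, v 2]

/-- `j₃ (a₁, a₂, b₁, b₂) = (b₁, b₂, -a₁, -a₂)`; the Hamiltonian vector field is `j₃ ∇H`. -/
def j3 (v : R4) : R4 := !₂[v 2, v 3, -v 0, -v 1]

/-! ### The quaternion frame and the linearized flow of a Hamiltonian -/

/-- The unit normal `X₀ = ∇H / |∇H|` to the level set of `H` (at a regular point). -/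
def X0 (H : R4 → ℝ) (w : R4) : R4 := ‖gradient H w‖⁻¹ • gradient H w

/-- The first vector of the transverse quaternion frame. -/
def X1 (H : R4 → ℝ) (w : R4) : R4 := j1 (X0 H w)

/-- The second vector of the transverse quaternion frame. -/
def X2 (H : R4 → ℝ) (w : R4) : R4 := j2 (X0 H w)

/-- The Hessian of `H` at `w`, as a linear map: the derivative of the gradient. -/
def hessian (H : R4 → ℝ) (w : R4) : R4 →L[ℝ] R4 := fderiv ℝ (gradient H) w

/-- `w` solves Hamilton's equations `ẇ = j₃ ∇H(w)` at all times in `J`. -/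
def IsTrajectoryOn (H : R4 → ℝ) (w : ℝ → R4) (J : Set ℝ) : Prop :=
  ∀ t ∈ J, HasDerivAt w (j3 (gradient H (w t))) t

/-- `u` is a linearized solution along `w` on `J`: it is tangent to the energy surface and
`u̇ = j₃ 𝓗(w) u`. -/
def IsLinearizedSolutionOn (H : R4 → ℝ) (w u : ℝ → R4) (J : Set ℝ) : Prop :=
  ∀ t ∈ J, inner ℝ (gradient H (w t)) (u t) = 0 ∧
    HasDerivAt u (j3 (hessian H (w t) (u t))) t

/-- The transverse part `α₁ + i α₂` of `u = α₁ X₁ + α₂ X₂ + α₃ X₃`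
(the frame `X₁, X₂, X₃` is orthonormal). -/
def transverse (H : R4 → ℝ) (w u : ℝ → R4) (t : ℝ) : ℂ :=
  ⟨inner ℝ (X1 H (w t)) (u t), inner ℝ (X2 H (w t)) (u t)⟩

/-- `θ` is a continuous argument on `J` of the nowhere vanishing curve `α`:
`α(t) ∈ ℝ⁺ e^{iθ(t)}`. -/
def IsContinuousArgumentOn (α : ℝ → ℂ) (θ : ℝ → ℝ) (J : Set ℝ) : Prop :=
  ContinuousOn θ J ∧
    ∀ t ∈ J, ∃ r : ℝ, 0 < r ∧ α t = (r : ℂ) * Complex.exp ((θ t : ℂ) * Complex.I)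

/-- The quaternion frame `{X₁, X₂}` of `H` is positive on `S`: on `S` it is a well-defined
symplectic frame, and every continuous argument `θ` of a non-vanishing transverse linearized
solution along any piece of trajectory in `S` is differentiable with `θ̇ > 0`.
(`deriv` is `0` where `θ` is not differentiable.) -/
def QuaternionFramePositive (H : R4 → ℝ) (S : Set R4) : Prop :=
  (∀ w ∈ S, gradient H w ≠ 0 ∧ omega0 (X1 H w) (X2 H w) = 1) ∧
  ∀ (a b : ℝ) (w u : ℝ → R4) (θ : ℝ → ℝ),
    (∀ t ∈ Ioo a b, w t ∈ S) →
    IsTrajectoryOn H w (Ioo a b) →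
    IsLinearizedSolutionOn H w u (Ioo a b) →
    IsContinuousArgumentOn (transverse H w u) θ (Ioo a b) →
    ∀ t ∈ Ioo a b, 0 < deriv θ t

/-! ### Periodic orbits and their index -/

/-- `P = (w, T)` is a (non-constant) periodic orbit; `T > 0` is a period,
not necessarily the least one. -/
def IsPeriodicOrbit (H : R4 → ℝ) (w : ℝ → R4) (T : ℝ) : Prop :=
  0 < T ∧ IsTrajectoryOn H w univ ∧ Function.Periodic w T ∧ ∃ t, w t ≠ w 0

/-- The set `I` of the numbers `(θ(T) - θ(0)) / 2π`, over all the non-vanishing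
transverse linearized solutions along `(w, T)`. -/
def rotationSet (H : R4 → ℝ) (w : ℝ → R4) (T : ℝ) : Set ℝ :=
  {r | ∃ (u : ℝ → R4) (θ : ℝ → ℝ),
    IsLinearizedSolutionOn H w u univ ∧
    IsContinuousArgumentOn (transverse H w u) θ univ ∧
    r = (θ T - θ 0) / (2 * Real.pi)}

/-- `μ` is the (generalized Conley–Zehnder) index of `(w, T)`: for all small `ε > 0`, with
`I_ε = I - ε`, either `μ = 2k + 1` and `I_ε ⊆ (k, k + 1)`, or `μ = 2k` and `k ∈ int I_ε`. -/
def HasIndex (H : R4 → ℝ) (w : ℝ → R4) (T : ℝ) (μ : ℤ) : Prop :=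
  ∀ᶠ ε in 𝓝[>] (0 : ℝ), ∃ k : ℤ,
    (μ = 2 * k + 1 ∧ (fun r => r - ε) '' rotationSet H w T ⊆ Ioo (k : ℝ) (k + 1)) ∨
    (μ = 2 * k ∧ (k : ℝ) ∈ interior ((fun r => r - ε) '' rotationSet H w T))

/-- `S` is dynamically convex: the index of every periodic orbit in `S` is (defined and)
at least `3`. -/
def DynamicallyConvex (H : R4 → ℝ) (S : Set R4) : Prop :=
  ∀ (w : ℝ → R4) (T : ℝ), IsPeriodicOrbit H w T → (∀ t, w t ∈ S) →
    (∃! μ : ℤ, HasIndex H w T μ) ∧ ∀ μ : ℤ, HasIndex H w T μ → 3 ≤ μ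

/-! ### The Hénon–Heiles system at the critical level `1/6` -/

/-- The Hénon–Heiles potential. -/
def V (x : R2) : ℝ :=
  (x 0 ^ 2 + x 1 ^ 2) / 2 + x 0 ^ 2 * x 1 - x 1 ^ 3 / 3

/-- The projection `(x, y) ↦ x`. -/
def proj (w : R4) : R2 := !₂[w 0, w 1]

/-- The Hénon–Heiles Hamiltonian `H = |y|²/2 + V(x)`. -/
def H (w : R4) : ℝ := (w 2 ^ 2 + w 3 ^ 2) / 2 + V (proj w)

/-- The first saddle point of the potential. -/
def v1 : R2 := !₂[0, 1]
/-- The second saddle point. -/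
def v2 : R2 := !₂[-(Real.sqrt 3) / 2, -1 / 2]
/-- The third saddle point. -/
def v3 : R2 := !₂[Real.sqrt 3 / 2, -1 / 2]

/-- The inclusion `x ↦ (x, 0)`. -/
def lift (x : R2) : R4 := !₂[x 0, x 1, 0, 0]

/-- `K_{1/6}`: the closed region bounded by the triangle with vertices `v₁, v₂, v₃`. -/
def K : Set R2 := convexHull ℝ {v1, v2, v3}

/-- `S_{1/6}`: the part of the energy surface `H = 1/6` that projects to `K_{1/6}`. -/
def S : Set R4 := {w | H w = 1 / 6 ∧ proj w ∈ K}

/-- The three saddle-centers `p₁, p₂, p₃`. -/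
def saddleCenters : Set R4 := {lift v1, lift v2, lift v3}

end HenonHeiles

end

/-!
The velocity of the argument of a transverse linearized solution `u` is, up to a positive factor,
the Hessian form of `H` on the transverse part of `u` plus a positive multiple of the Hessian form
on the flow direction. So `θ̇ > 0` wherever the energy surface is convex and strictly convex along
the flow. The transverse plane is turned by area-preserving maps, hence the rotation set of a
periodic orbit is an interval `[a, b]` with `b - a < 1 / 2`, and the index is at least `3` as soon
as every transverse solution turns by more than `2π` in a period. The skew product of a linearized
solution with its translate by a period is constant, so it is enough that each one does so from
some starting time.

For `H = |y|²/2 + U(x)` suppose that a solution with position part `ξ` turns by at most `2π`. The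
area `J` of `(y, ξ)` has the imaginary part of the transverse coordinate as its derivative, which
bounds the number of zeros of `J` in a period started at a zero of `J`: there is at most one, and it
is simple. The Lagrangian plane spanned by the trajectory and `ξ` is the graph of a symmetric `R`
with `Ṙ = -D²U - R²`, and for a test field `X = v + κ x` convexity makes
`⟪R X, X⟫ - 2 κ ⟪y, X⟫` strictly decreasing. The three parameters `(v, κ)` are enough to make `X`
tangent to the trajectory at the initial time and to remove the pole of the form at the zero of
`J`. The form then has the same finite limit at both ends of the period, a contradiction. If the
initial point is a brake point, `y = 0`, the limits are read off from `cot θ` instead.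

The Hénon–Heiles potential is `(1 - ℓ₁ ℓ₂ ℓ₃) / 6` for affine functions `ℓᵢ ≥ 0` on the triangle
which vanish on its sides, and the convexity of the energy surface is an inequality between the
`ℓᵢ` and their increments.
-/

noncomputable section

namespace HenonHeiles

theorem inner_R4 (u v : R4) :
    inner ℝ u v = u 0 * v 0 + u 1 * v 1 + u 2 * v 2 + u 3 * v 3 := by
  simp [PiLp.inner_apply, Fin.sum_univ_four, mul_comm]

theorem norm_sq_R4 (v : R4) : ‖v‖ ^ 2 = v 0 ^ 2 + v 1 ^ 2 + v 2 ^ 2 + v 3 ^ 2 := by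
  rw [← real_inner_self_eq_norm_sq, inner_R4]
  ring

theorem omega0_eq_inner_j3 (u v : R4) : omega0 u v = inner ℝ (j3 u) v := by
  simp only [omega0, j3, inner_R4, Matrix.cons_val]
  ring

theorem hasDerivAt_euclidean {ι : Type*} [Fintype ι] {w : ℝ → EuclideanSpace ℝ ι}
    {w' : EuclideanSpace ℝ ι} {t : ℝ} :
    HasDerivAt w w' t ↔ ∀ i, HasDerivAt (fun s => w s i) (w' i) t :=
  ⟨fun h i => (EuclideanSpace.proj (𝕜 := ℝ) i).hasFDerivAt.comp_hasDerivAt t h, fun h =>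
    (EuclideanSpace.equiv ι ℝ).symm.hasFDerivAt.comp_hasDerivAt t (hasDerivAt_pi.2 h)⟩

/-- The coordinates of `u` along `j₁ n` and `j₂ n`, as a complex number. For `n = ∇H` this is
`|∇H|` times the transverse part of `u`; dropping the normalization makes it bilinear in `n`
and `u`. -/
def transverseCoord (n u : R4) : ℂ := ⟨inner ℝ (j1 n) u, inner ℝ (j2 n) u⟩

/-- The oriented area of the parallelogram spanned by two complex numbers. -/
def wedge (z w : ℂ) : ℝ := z.re * w.im - z.im * w.re

theorem norm_sq_smul_eq {n u : R4} (hu : inner ℝ n u = 0) :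
    ‖n‖ ^ 2 • u = (transverseCoord n u).re • j1 n + (transverseCoord n u).im • j2 n
      + inner ℝ (j3 n) u • j3 n := by
  rw [norm_sq_R4]
  rw [inner_R4] at hu
  ext i
  fin_cases i <;> simp only [transverseCoord, inner_R4, j1, j2, j3, PiLp.add_apply,
    PiLp.smul_apply, smul_eq_mul, Fin.zero_eta, Fin.mk_one, Fin.reduceFinMk, Matrix.cons_val]
  · linear_combination n 0 * hu
  · linear_combination n 1 * hu
  · linear_combination n 2 * hu
  · linear_combination n 3 * hu

theorem wedge_transverseCoord {n u v : R4} (hu : inner ℝ n u = 0) (hv : inner ℝ n v = 0) :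
    wedge (transverseCoord n u) (transverseCoord n v) = ‖n‖ ^ 2 * omega0 u v := by
  rw [norm_sq_R4]
  rw [inner_R4] at hu hv
  simp only [wedge, transverseCoord, omega0, inner_R4, j1, j2, Matrix.cons_val]
  linear_combination (n 2 * u 0 + n 3 * u 1 - n 0 * u 2 - n 1 * u 3) * hv
    - (n 2 * v 0 - n 0 * v 2 + (n 3 * v 1 - n 1 * v 3)) * hu

-- The component of `u` along the flow direction `j3 n` does not contribute to the right-hand side.
theorem rotation_identity (B : R4 →ₗ[ℝ] R4) {n u : R4} (hu : inner ℝ n u = 0) :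
    ‖n‖ ^ 2 * wedge (transverseCoord n u)
        (transverseCoord (B (j3 n)) u + transverseCoord n (j3 (B u))) =
      inner ℝ (B ((transverseCoord n u).re • j1 n + (transverseCoord n u).im • j2 n))
          ((transverseCoord n u).re • j1 n + (transverseCoord n u).im • j2 n)
        + Complex.normSq (transverseCoord n u) * inner ℝ (B (j3 n)) (j3 n) := by
  have hB : ‖n‖ ^ 2 • B u = (transverseCoord n u).re • B (j1 n)
      + (transverseCoord n u).im • B (j2 n) + inner ℝ (j3 n) u • B (j3 n) := by
    rw [← map_smul, norm_sq_smul_eq hu, map_add, map_add, map_smul, map_smul, map_smul]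
  have hp := congr(inner ℝ (j1 n) $hB)
  have hq := congr(inner ℝ (j2 n) $hB)
  rw [norm_sq_R4] at hp hq ⊢
  rw [inner_R4] at hu
  rw [map_add, map_smul, map_smul]
  generalize B u = Bu at *
  generalize B (j1 n) = Bp at *
  generalize B (j2 n) = Bq at *
  generalize B (j3 n) = Bm at *
  simp only [wedge, transverseCoord, Complex.normSq_apply, Complex.add_re, Complex.add_im, inner_R4,
    j1, j2, j3, PiLp.add_apply, PiLp.smul_apply, smul_eq_mul, Matrix.cons_val] at hp hq ⊢
  linear_combination (n 3 * u 0 - n 2 * u 1 + n 1 * u 2 - n 0 * u 3) * hp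
    + (n 1 * u 0 - n 0 * u 1 - n 3 * u 2 + n 2 * u 3) * hq
    + ((n 1 * u 0 - n 0 * u 1 - n 3 * u 2 + n 2 * u 3)
        * (n 3 * Bm 0 - n 2 * Bm 1 + n 1 * Bm 2 - n 0 * Bm 3)
      - (n 3 * u 0 - n 2 * u 1 + n 1 * u 2 - n 0 * u 3)
        * (n 1 * Bm 0 - n 0 * Bm 1 - n 3 * Bm 2 + n 2 * Bm 3)) * hu

theorem hasDerivAt_transverseCoord {n u : ℝ → R4} {n' u' : R4} {t : ℝ} (hn : HasDerivAt n n' t)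
    (hu : HasDerivAt u u' t) :
    HasDerivAt (fun s => transverseCoord (n s) (u s))
      (transverseCoord n' (u t) + transverseCoord (n t) u') t := by
  have hn := hasDerivAt_euclidean.1 hn
  have h1 : HasDerivAt (fun s => j1 (n s)) (j1 n') t := hasDerivAt_euclidean.2 <| by
    simpa [Fin.forall_fin_succ, j1] using ⟨hn 3, (hn 2).neg, hn 1, (hn 0).neg⟩
  have h2 : HasDerivAt (fun s => j2 (n s)) (j2 n') t := hasDerivAt_euclidean.2 <| by
    simpa [Fin.forall_fin_succ, j2] using ⟨hn 1, (hn 0).neg, (hn 3).neg, hn 2⟩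
  refine (Complex.equivRealProdCLM.symm.hasFDerivAt.comp_hasDerivAt t
    ((h1.inner ℝ hu).prodMk (h2.inner ℝ hu))).congr_deriv ?_
  apply Complex.ext <;> simp [transverseCoord, add_comm]

theorem continuous_transverseCoord {n u : ℝ → R4} (hn : Continuous n) (hu : Continuous u) :
    Continuous fun t => transverseCoord (n t) (u t) := by
  have h1 : Continuous fun t => inner ℝ (j1 (n t)) (u t) := by
    simp only [inner_R4, j1, Matrix.cons_val]; fun_prop
  have h2 : Continuous fun t => inner ℝ (j2 (n t)) (u t) := by
    simp only [inner_R4, j2, Matrix.cons_val]; fun_prop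
  exact Complex.equivRealProdCLM.symm.continuous.comp (h1.prodMk h2)

theorem transverse_eq (F : R4 → ℝ) (w u : ℝ → R4) (t : ℝ) :
    transverse F w u t =
      (‖gradient F (w t)‖⁻¹ : ℝ) * transverseCoord (gradient F (w t)) (u t) := by
  apply Complex.ext <;>
    simp only [transverse, transverseCoord, X1, X2, X0, inner_R4, j1, j2, PiLp.smul_apply,
      smul_eq_mul, Matrix.cons_val, Complex.re_ofReal_mul, Complex.im_ofReal_mul] <;> ring

theorem omega0_frame {F : R4 → ℝ} {w : R4} (hF : gradient F w ≠ 0) :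
    omega0 (X1 F w) (X2 F w) = 1 := by
  have hsq : ‖gradient F w‖⁻¹ ^ 2 * ‖gradient F w‖ ^ 2 = 1 := by
    rw [← mul_pow, inv_mul_cancel₀ (norm_ne_zero_iff.2 hF), one_pow]
  rw [norm_sq_R4] at hsq
  simp only [omega0, X1, X2, X0, j1, j2, PiLp.smul_apply, smul_eq_mul, Matrix.cons_val]
  linear_combination hsq

/-! ### Continuous arguments and rotation numbers of plane curves -/

theorem exists_continuous_polar {A : Type*} [TopologicalSpace A] [SimplyConnectedSpace A]
    [LocallyPathConnectedSpace A] {z : A → ℂ} (hz : Continuous z) (h0 : ∀ a, z a ≠ 0) :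
    ∃ θ : A → ℝ, Continuous θ ∧ ∀ a, z a = ‖z a‖ * Complex.exp (θ a * Complex.I) := by
  obtain ⟨a₀⟩ : Nonempty A := inferInstance
  obtain ⟨E, ⟨-, hE⟩, -⟩ := Complex.isCoveringMapOn_exp.existsUnique_continuousMap_lifts ⟨z, hz⟩
    (Complex.exp_log (h0 a₀)) h0
  refine ⟨fun a => (E a).im, by fun_prop, fun a => ?_⟩
  have hEa : Complex.exp (E a) = z a := congrFun hE a
  rw [← hEa, Complex.norm_exp, Complex.ofReal_exp, ← Complex.exp_add, Complex.re_add_im]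

theorem abs_sub_lt_pi_of_sin_ne_zero {X : Type*} [TopologicalSpace X] [PreconnectedSpace X]
    {δ : X → ℝ} (hδ : Continuous δ) (h : ∀ x, Real.sin (δ x) ≠ 0) (x y : X) :
    |δ x - δ y| < Real.pi := by
  have hlt (x y : X) : δ y - δ x < Real.pi := by
    by_contra! hle
    have hfloor : ⌊δ y / Real.pi⌋ * Real.pi ≤ δ y :=
      (le_div_iff₀ Real.pi_pos).1 (Int.floor_le _)
    have hceil : δ y < (⌊δ y / Real.pi⌋ + 1) * Real.pi :=
      (div_lt_iff₀ Real.pi_pos).1 (Int.lt_floor_add_one _)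
    obtain ⟨s, hs⟩ := mem_range_of_exists_le_of_exists_ge hδ ⟨x, by linarith⟩ ⟨y, hfloor⟩
    exact h s (by rw [hs, Real.sin_int_mul_pi])
  exact abs_lt.2 ⟨by linarith [hlt x y], hlt y x⟩

theorem eq_of_sin_eq_zero {X : Type*} [TopologicalSpace X] [PreconnectedSpace X]
    {δ : X → ℝ} (hδ : Continuous δ) (h : ∀ x, Real.sin (δ x) = 0) (x y : X) : δ x = δ y := by
  choose n hn using fun x => Real.sin_eq_zero_iff.1 (h x)
  have hn_continuous : Continuous n :=
    Int.isClosedEmbedding_coe_real.isInducing.continuous_iff.2 <|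
      (hδ.div_const Real.pi).congr fun x => by
        rw [← hn x, mul_div_cancel_right₀ _ Real.pi_ne_zero, Function.comp_apply]
  rw [← hn x, ← hn y, PreconnectedSpace.constant ‹_› hn_continuous]

theorem wedge_polar {r s a b : ℝ} {z w : ℂ} (hz : z = r * Complex.exp (a * Complex.I))
    (hw : w = s * Complex.exp (b * Complex.I)) : wedge z w = r * s * Real.sin (b - a) := by
  rw [hz, hw, Complex.exp_mul_I, Complex.exp_mul_I, Real.sin_sub]
  simp only [wedge, Complex.mul_re, Complex.mul_im, Complex.add_re, Complex.add_im, Complex.I_re,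
    Complex.I_im, Complex.ofReal_re, Complex.ofReal_im, ← Complex.ofReal_cos, ← Complex.ofReal_sin]
  ring

namespace IsContinuousArgumentOn

variable {z z₁ z₂ : ℝ → ℂ} {θ θ₁ θ₂ : ℝ → ℝ} {I : Set ℝ}

theorem ne_zero (h : IsContinuousArgumentOn z θ I) {t : ℝ} (ht : t ∈ I) : z t ≠ 0 := by
  obtain ⟨r, hr, hrt⟩ := h.2 t ht
  rw [hrt]
  exact mul_ne_zero (by exact_mod_cast hr.ne') (Complex.exp_ne_zero _)

theorem continuous (h : IsContinuousArgumentOn z θ univ) : Continuous θ :=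
  continuousOn_univ.1 h.1

theorem ofReal_mul (h : IsContinuousArgumentOn z θ I) {ρ : ℝ → ℝ} (hρ : ∀ t ∈ I, 0 < ρ t) :
    IsContinuousArgumentOn (fun t => ρ t * z t) θ I := by
  refine ⟨h.1, fun t ht => ?_⟩
  obtain ⟨r, hr, hrt⟩ := h.2 t ht
  exact ⟨ρ t * r, mul_pos (hρ t ht) hr, by simp only [hrt, Complex.ofReal_mul, mul_assoc]⟩

theorem congr_curve {z' : ℝ → ℂ} (h : IsContinuousArgumentOn z θ I) (hz : ∀ t ∈ I, z t = z' t) :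
    IsContinuousArgumentOn z' θ I :=
  ⟨h.1, fun t ht => hz t ht ▸ h.2 t ht⟩

theorem hasDerivAt {z' : ℂ} (h : IsContinuousArgumentOn z θ I) {t : ℝ} (hI : I ∈ 𝓝 t)
    (hz : HasDerivAt z z' t) : HasDerivAt θ (wedge (z t) z' / Complex.normSq (z t)) t := by
  have hzt : z t ≠ 0 := h.ne_zero (mem_of_mem_nhds hI)
  have hlog : HasDerivAt (fun s => (Complex.log (z s / z t)).im + θ t) (z' / z t).im t := by
    have := (hz.div_const (z t)).clog_real (by rw [div_self hzt]; exact Complex.one_mem_slitPlane)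
    rw [div_self hzt, div_one] at this
    exact (Complex.imCLM.hasFDerivAt.comp_hasDerivAt t this).add_const (θ t)
  rw [show wedge (z t) z' / Complex.normSq (z t) = (z' / z t).im by
    rw [Complex.div_im, wedge]; ring]
  refine hlog.congr_of_eventuallyEq ?_
  have hnear : ∀ᶠ s in 𝓝 t, θ s ∈ Ioo (θ t - Real.pi) (θ t + Real.pi) :=
    (h.1.continuousAt hI).eventually
      (Ioo_mem_nhds (by linarith [Real.pi_pos]) (by linarith [Real.pi_pos]))
  filter_upwards [hnear, hI] with s hs hsI
  obtain ⟨r, hr, hrt⟩ := h.2 t (mem_of_mem_nhds hI)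
  obtain ⟨r', hr', hrs⟩ := h.2 s hsI
  have hquot : z s / z t =
      ((r' / r : ℝ) : ℂ) * Complex.exp (((θ s - θ t : ℝ) : ℂ) * Complex.I) := by
    rw [hrs, hrt]
    push_cast
    rw [sub_mul, Complex.exp_sub]
    field_simp
  rw [hquot, Complex.log_im, Complex.arg_real_mul _ (div_pos hr' hr), Complex.arg_exp_mul_I,
    toIocMod_eq_self (hp := Real.two_pi_pos) |>.2 ⟨by linarith [hs.1], by linarith [hs.2]⟩]
  ring

theorem sin_sub_eq_zero_iff (h₁ : IsContinuousArgumentOn z₁ θ₁ I)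
    (h₂ : IsContinuousArgumentOn z₂ θ₂ I) {t : ℝ} (ht : t ∈ I) :
    Real.sin (θ₂ t - θ₁ t) = 0 ↔ wedge (z₁ t) (z₂ t) = 0 := by
  obtain ⟨r₁, hr₁, hz₁⟩ := h₁.2 t ht
  obtain ⟨r₂, hr₂, hz₂⟩ := h₂.2 t ht
  rw [wedge_polar hz₁ hz₂, mul_eq_zero, or_iff_right (mul_pos hr₁ hr₂).ne']

theorem abs_turn_sub_turn_lt_pi (h₁ : IsContinuousArgumentOn z₁ θ₁ univ)
    (h₂ : IsContinuousArgumentOn z₂ θ₂ univ) (h : ∀ t, wedge (z₁ t) (z₂ t) ≠ 0) (s t : ℝ) :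
    |(θ₂ t - θ₂ s) - (θ₁ t - θ₁ s)| < Real.pi := by
  rw [sub_sub_sub_comm]
  exact abs_sub_lt_pi_of_sin_ne_zero (h₂.continuous.sub h₁.continuous)
    (fun t => (h₁.sin_sub_eq_zero_iff h₂ (mem_univ t)).not.2 (h t)) t s

theorem turn_eq_turn (h₁ : IsContinuousArgumentOn z₁ θ₁ univ)
    (h₂ : IsContinuousArgumentOn z₂ θ₂ univ) (h : ∀ t, wedge (z₁ t) (z₂ t) = 0) (s t : ℝ) :
    θ₂ t - θ₂ s = θ₁ t - θ₁ s := by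
  have := eq_of_sin_eq_zero (h₂.continuous.sub h₁.continuous)
    (fun t => (h₁.sin_sub_eq_zero_iff h₂ (mem_univ t)).2 (h t)) t s
  simp only [Pi.sub_apply] at this
  linarith

end IsContinuousArgumentOn

/-- The rotation numbers over `[0, T]` of the non-vanishing linear combinations of two plane
curves. -/
def planeRotationSet (z₁ z₂ : ℝ → ℂ) (T : ℝ) : Set ℝ :=
  {r | ∃ (x y : ℝ) (θ : ℝ → ℝ), IsContinuousArgumentOn (fun t => x * z₁ t + y * z₂ t) θ univ ∧
    r = (θ T - θ 0) / (2 * Real.pi)}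

theorem wedge_combination (x₁ y₁ x₂ y₂ : ℝ) (z₁ z₂ : ℂ) :
    wedge (x₁ * z₁ + y₁ * z₂) (x₂ * z₁ + y₂ * z₂) = (x₁ * y₂ - y₁ * x₂) * wedge z₁ z₂ := by
  simp only [wedge, Complex.add_re, Complex.add_im, Complex.re_ofReal_mul, Complex.im_ofReal_mul]
  ring

theorem combination_ne_zero {x y : ℝ} {z₁ z₂ : ℂ} (h : wedge z₁ z₂ ≠ 0) (hxy : x ^ 2 + y ^ 2 ≠ 0) :
    x * z₁ + y * z₂ ≠ 0 := by
  intro h0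
  have hrot := wedge_combination x y (-y) x z₁ z₂
  rw [h0, show wedge 0 _ = 0 by simp [wedge], eq_comm, mul_eq_zero, or_iff_left h] at hrot
  exact hxy (by linear_combination hrot)

section PlaneRotation

variable {z₁ z₂ : ℝ → ℂ}

theorem exists_planeRotationSet_eq_image (h₁ : Continuous z₁) (h₂ : Continuous z₂)
    (h : ∀ t, wedge (z₁ t) (z₂ t) ≠ 0) (T : ℝ) :
    ∃ R : ℝ → ℝ, Continuous R ∧ planeRotationSet z₁ z₂ T = R '' Icc (-Real.pi) Real.pi := by
  obtain ⟨Θ, hΘc, hΘ⟩ := exists_continuous_polar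
    (z := fun p : ℝ × ℝ => (Real.cos p.1 : ℂ) * z₁ p.2 + (Real.sin p.1 : ℂ) * z₂ p.2)
    (by fun_prop) (fun p => combination_ne_zero (h p.2) (by simp))
  have hΘarg (φ : ℝ) : IsContinuousArgumentOn
      (fun t => Real.cos φ * z₁ t + Real.sin φ * z₂ t) (fun t => Θ (φ, t)) univ :=
    ⟨by fun_prop, fun t _ => ⟨_, norm_pos_iff.2 (combination_ne_zero (h t) (by simp)), hΘ (φ, t)⟩⟩
  refine ⟨fun φ => (Θ (φ, T) - Θ (φ, 0)) / (2 * Real.pi), by fun_prop, ?_⟩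
  refine Subset.antisymm ?_ ?_
  · rintro _ ⟨x, y, θ, hθ, rfl⟩
    let c : ℂ := ⟨x, y⟩
    refine ⟨c.arg, ⟨(Complex.neg_pi_lt_arg c).le, Complex.arg_le_pi c⟩, ?_⟩
    dsimp only
    have hx : ‖c‖ * Real.cos c.arg = x := Complex.norm_mul_cos_arg c
    have hy : ‖c‖ * Real.sin c.arg = y := Complex.norm_mul_sin_arg c
    rw [hθ.turn_eq_turn (hΘarg c.arg) fun t => ?_]
    rw [wedge_combination, mul_eq_zero]
    left
    linear_combination Real.cos c.arg * hy - Real.sin c.arg * hx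
  · rintro _ ⟨φ, -, rfl⟩
    exact ⟨_, _, _, hΘarg φ, rfl⟩

theorem abs_sub_lt_of_mem_planeRotationSet (h : ∀ t, wedge (z₁ t) (z₂ t) ≠ 0) {T r s : ℝ}
    (hr : r ∈ planeRotationSet z₁ z₂ T) (hs : s ∈ planeRotationSet z₁ z₂ T) : |r - s| < 1 / 2 := by
  obtain ⟨x₁, y₁, θ₁, h₁, rfl⟩ := hr
  obtain ⟨x₂, y₂, θ₂, h₂, rfl⟩ := hs
  have hpi := Real.pi_pos
  have hlt : |(θ₁ T - θ₁ 0) - (θ₂ T - θ₂ 0)| < Real.pi := by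
    by_cases hd : x₂ * y₁ - y₂ * x₁ = 0
    · rw [h₂.turn_eq_turn h₁ fun t => by rw [wedge_combination, hd, zero_mul]]
      simpa using hpi
    · exact h₂.abs_turn_sub_turn_lt_pi h₁
        (fun t => by rw [wedge_combination]; exact mul_ne_zero hd (h t)) 0 T
  rw [← sub_div, abs_div, abs_of_pos Real.two_pi_pos, div_lt_iff₀ Real.two_pi_pos]
  linarith

theorem exists_planeRotationSet_eq_Icc (h₁ : Continuous z₁) (h₂ : Continuous z₂)
    (h : ∀ t, wedge (z₁ t) (z₂ t) ≠ 0) (T : ℝ) :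
    ∃ a b : ℝ, a ≤ b ∧ b < a + 1 / 2 ∧ planeRotationSet z₁ z₂ T = Icc a b := by
  obtain ⟨R, hR, hset⟩ := exists_planeRotationSet_eq_image h₁ h₂ h T
  have hIcc := hset.trans (hR.continuousOn.image_Icc (neg_le_self Real.pi_pos.le))
  have hne : (planeRotationSet z₁ z₂ T).Nonempty := by
    rw [hset]; exact (nonempty_Icc.2 (neg_le_self Real.pi_pos.le)).image R
  have hab := nonempty_Icc.1 (hIcc ▸ hne)
  refine ⟨_, _, hab, ?_, hIcc⟩
  have := abs_sub_lt_of_mem_planeRotationSet h (hIcc ▸ right_mem_Icc.2 hab)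
    (hIcc ▸ left_mem_Icc.2 hab)
  linarith [le_abs_self (sSup (R '' Icc (-Real.pi) Real.pi) - sInf (R '' Icc (-Real.pi) Real.pi))]

end PlaneRotation

/-! ### Linear differential equations -/

section LinearODE

variable {E : Type*} [NormedAddCommGroup E] [NormedSpace ℝ E]

/-- The terms of the Dyson series, whose sum solves the linear equation `u' = A u`, `u 0 = v`. -/
def dyson (A : ℝ → E →L[ℝ] E) (v : E) : ℕ → ℝ → E
  | 0 => fun _ => v
  | n + 1 => fun t => ∫ s in (0 : ℝ)..t, A s (dyson A v n s)

theorem dyson_succ_zero (A : ℝ → E →L[ℝ] E) (v : E) (n : ℕ) : dyson A v (n + 1) 0 = 0 :=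
  intervalIntegral.integral_same

variable {A : ℝ → E →L[ℝ] E} (hA : Continuous A) (v : E)
include hA

theorem exists_norm_le_of_abs_le (R : ℝ) : ∃ C, 0 ≤ C ∧ ∀ s, |s| ≤ R → ‖A s‖ ≤ C := by
  obtain ⟨C, hC⟩ :=
    (isCompact_Icc (a := -R) (b := R)).exists_bound_of_continuousOn hA.continuousOn
  exact ⟨max C 0, le_max_right _ _, fun s hs => (hC s (abs_le.1 hs)).trans (le_max_left _ _)⟩

theorem continuous_dyson (n : ℕ) : Continuous (dyson A v n) := by
  induction n with
  | zero => exact continuous_const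
  | succ n ih =>
    exact intervalIntegral.continuous_primitive
      (fun a b => (hA.clm_apply ih).intervalIntegrable a b) 0

theorem norm_dyson_le {C R t : ℝ} (hC : ∀ s, |s| ≤ R → ‖A s‖ ≤ C) (ht : |t| ≤ R) (n : ℕ) :
    ‖dyson A v n t‖ ≤ ‖v‖ * ((C * |t|) ^ n / n.factorial) := by
  induction n generalizing t with
  | zero => simp [dyson]
  | succ n ih =>
    have hle : ‖dyson A v (n + 1) t‖ ≤
        ∫ s in Set.uIoc 0 t, C * (‖v‖ * (C ^ n / n.factorial)) * |s - 0| ^ n := by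
      refine intervalIntegral.norm_integral_le_integral_norm_uIoc.trans ?_
      refine MeasureTheory.setIntegral_mono_on ?_ ?_ measurableSet_uIoc fun s hs => ?_
      · exact (hA.clm_apply (continuous_dyson hA v n)).norm.integrableOn_uIoc
      · exact Continuous.integrableOn_uIoc (by fun_prop)
      · have hsR : |s| ≤ R := by
          simpa using (abs_sub_left_of_mem_uIcc (uIoc_subset_uIcc hs)).trans (by simpa using ht)
        calc ‖A s (dyson A v n s)‖ ≤ C * (‖v‖ * ((C * |s|) ^ n / n.factorial)) :=
              (A s).le_of_opNorm_le_of_le (hC s hsR) (ih hsR)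
          _ = C * (‖v‖ * (C ^ n / n.factorial)) * |s - 0| ^ n := by rw [sub_zero, mul_pow]; ring
    refine hle.trans (le_of_eq ?_)
    rw [MeasureTheory.integral_const_mul, integral_pow_abs_sub_uIoc, sub_zero, Nat.factorial_succ]
    push_cast
    rw [mul_pow]
    field_simp
    ring

variable [CompleteSpace E]

theorem hasDerivAt_dyson_succ (n : ℕ) (t : ℝ) :
    HasDerivAt (dyson A v (n + 1)) (A t (dyson A v n t)) t :=
  (hA.clm_apply (continuous_dyson hA v n)).integral_hasStrictDerivAt 0 t |>.hasDerivAt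

theorem summable_dyson (t : ℝ) : Summable fun n => dyson A v n t := by
  obtain ⟨C, -, hC⟩ := exists_norm_le_of_abs_le hA |t|
  exact Summable.of_norm_bounded ((Real.summable_pow_div_factorial (C * |t|)).mul_left _)
    (norm_dyson_le hA v hC le_rfl)

theorem hasDerivAt_tsum_dyson_succ (t : ℝ) :
    HasDerivAt (fun t => ∑' n, dyson A v (n + 1) t) (∑' n, A t (dyson A v n t)) t := by
  set R := |t| + 1 with hR
  obtain ⟨C, hC0, hC⟩ := exists_norm_le_of_abs_le hA R
  have hbound : Summable fun n : ℕ => C * (‖v‖ * ((C * R) ^ n / n.factorial)) :=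
    ((Real.summable_pow_div_factorial (C * R)).mul_left _).mul_left _
  refine hasDerivAt_tsum_of_isPreconnected hbound (t := Metric.ball 0 R) (y₀ := 0)
    Metric.isOpen_ball (convex_ball _ _).isPreconnected
    (fun n s _ => hasDerivAt_dyson_succ hA v n s) (fun n s hs => ?_) ?_ ?_ ?_
  · have hsR : |s| ≤ R := by simpa using (mem_ball_zero_iff.1 hs).le
    calc ‖A s (dyson A v n s)‖ ≤ C * (‖v‖ * ((C * |s|) ^ n / n.factorial)) :=
          (A s).le_of_opNorm_le_of_le (hC s hsR) (norm_dyson_le hA v hC hsR n)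
      _ ≤ C * (‖v‖ * ((C * R) ^ n / n.factorial)) := by gcongr
  · exact Metric.mem_ball_self (by positivity)
  · simp only [dyson_succ_zero, summable_zero]
  · simp [hR]

theorem exists_linearODE_solution :
    ∃ u : ℝ → E, u 0 = v ∧ ∀ t, HasDerivAt u (A t (u t)) t := by
  have htsum (t : ℝ) : ∑' n, dyson A v n t = v + ∑' n, dyson A v (n + 1) t :=
    (summable_dyson hA v t).tsum_eq_zero_add
  refine ⟨fun t => ∑' n, dyson A v n t, ?_, fun t => ?_⟩
  · simp only [htsum, dyson_succ_zero, tsum_zero, add_zero]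
  · have hderiv := (hasDerivAt_tsum_dyson_succ hA v t).const_add v
    rw [← (A t).map_tsum (summable_dyson hA v t)] at hderiv
    simpa only [htsum] using hderiv

end LinearODE

/-! ### Linearized solutions along a trajectory -/

section Gradient

variable {E : Type*} [NormedAddCommGroup E] [InnerProductSpace ℝ E] [CompleteSpace E] {f : E → ℝ}

theorem contDiff_one_gradient (hf : ContDiff ℝ 2 f) : ContDiff ℝ 1 (gradient f) :=
  (InnerProductSpace.toDual ℝ E).symm.contDiff.comp (hf.fderiv_right (by norm_num))

theorem differentiable_gradient (hf : ContDiff ℝ 2 f) : Differentiable ℝ (gradient f) :=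
  (contDiff_one_gradient hf).differentiable one_ne_zero

theorem isSymmetric_fderiv_gradient (hf : ContDiff ℝ 2 f) (x : E) :
    (fderiv ℝ (gradient f) x : E →ₗ[ℝ] E).IsSymmetric := by
  have hsnd (u v : E) :
      inner ℝ (fderiv ℝ (gradient f) x u) v = fderiv ℝ (fderiv ℝ f) x u v := by
    have hright := (differentiable_gradient hf x).hasFDerivAt.inner ℝ (hasFDerivAt_const v x)
    have hleft : HasFDerivAt (fun y => fderiv ℝ f y v) _ x :=
      ((hf.fderiv_right (m := 1) (by norm_num)).differentiable one_ne_zero x).hasFDerivAt.clm_apply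
        (hasFDerivAt_const v x)
    simp only [inner_gradient_left] at hright
    simpa using congr($(hright.unique hleft) u)
  intro u v
  have := (hf.contDiffAt (x := x)).isSymmSndFDerivAt (by simp)
  rw [ContinuousLinearMap.coe_coe, hsnd, this.eq, ← hsnd, real_inner_comm]

end Gradient

theorem inner_j3_left (u v : R4) : inner ℝ (j3 u) v = -inner ℝ u (j3 v) := by
  simp only [inner_R4, j3, Matrix.cons_val]
  ring

theorem j3_j3 (v : R4) : j3 (j3 v) = -v := by
  ext i; fin_cases i <;> simp [j3]

/-- `j₃` as a continuous linear map. -/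
def j3L : R4 →L[ℝ] R4 :=
  LinearMap.toContinuousLinearMap
    { toFun := j3
      map_add' := fun u v => by ext i; fin_cases i <;> simp [j3] <;> ring
      map_smul' := fun c v => by ext i; fin_cases i <;> simp [j3] }

theorem hasDerivAt_j3 {u : ℝ → R4} {u' : R4} {t : ℝ} (hu : HasDerivAt u u' t) :
    HasDerivAt (fun s => j3 (u s)) (j3 u') t :=
  j3L.hasFDerivAt.comp_hasDerivAt t hu

theorem omega0_eq_omega0_of_hasDerivAt {B : ℝ → R4 →L[ℝ] R4}
    (hB : ∀ t, (B t : R4 →ₗ[ℝ] R4).IsSymmetric) {u v : ℝ → R4}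
    (hu : ∀ t, HasDerivAt u (j3 (B t (u t))) t) (hv : ∀ t, HasDerivAt v (j3 (B t (v t))) t)
    (s t : ℝ) : omega0 (u s) (v s) = omega0 (u t) (v t) := by
  have hconst (t : ℝ) : HasDerivAt (fun s => omega0 (u s) (v s)) 0 t := by
    simp only [omega0_eq_inner_j3]
    refine ((hasDerivAt_j3 (hu t)).inner ℝ (hv t)).congr_deriv ?_
    have hsymm : inner ℝ (B t (u t)) (v t) = inner ℝ (u t) (B t (v t)) := hB t _ _
    rw [inner_j3_left, j3_j3, j3_j3, inner_neg_right, inner_neg_left, hsymm]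
    ring
  exact is_const_of_deriv_eq_zero (fun s => (hconst s).differentiableAt)
    (fun s => (hconst s).deriv) s t

section Linearized

variable {F : R4 → ℝ} {w u : ℝ → R4} {I : Set ℝ} {t : ℝ}

theorem hasDerivAt_gradient_trajectory (hF : Differentiable ℝ (gradient F))
    (hw : IsTrajectoryOn F w I) (ht : t ∈ I) :
    HasDerivAt (fun s => gradient F (w s)) (hessian F (w t) (j3 (gradient F (w t)))) t :=
  (hF (w t)).hasFDerivAt.comp_hasDerivAt t (hw t ht)

theorem IsTrajectoryOn.continuous (hw : IsTrajectoryOn F w univ) : Continuous w :=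
  continuous_iff_continuousAt.2 fun t => (hw t (mem_univ t)).continuousAt

theorem IsLinearizedSolutionOn.continuous (hu : IsLinearizedSolutionOn F w u univ) :
    Continuous u :=
  continuous_iff_continuousAt.2 fun t => (hu t (mem_univ t)).2.continuousAt

theorem exists_linearizedSolution (hF : ContDiff ℝ 2 F) (hw : IsTrajectoryOn F w univ) {v : R4}
    (hv : inner ℝ (gradient F (w 0)) v = 0) :
    ∃ u, IsLinearizedSolutionOn F w u univ ∧ u 0 = v := by
  have hhess : Continuous (hessian F) := (contDiff_one_gradient hF).continuous_fderiv one_ne_zero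
  obtain ⟨u, hu0, hu⟩ := exists_linearODE_solution (A := fun t => j3L.comp (hessian F (w t)))
    (continuous_const.clm_comp (hhess.comp hw.continuous)) v
  refine ⟨u, fun t _ => ⟨?_, hu t⟩, hu0⟩
  have hω := omega0_eq_omega0_of_hasDerivAt (fun t => isSymmetric_fderiv_gradient hF (w t))
    (fun t => hasDerivAt_j3 (hasDerivAt_gradient_trajectory (differentiable_gradient hF) hw
      (mem_univ t))) hu t 0
  simpa only [omega0_eq_inner_j3, j3_j3, inner_neg_left, neg_inj, hu0, hv] using hω

theorem hasDerivAt_transverseCoord_linearized (hF : Differentiable ℝ (gradient F))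
    (hw : IsTrajectoryOn F w I) (hu : IsLinearizedSolutionOn F w u I) (ht : t ∈ I) :
    HasDerivAt (fun s => transverseCoord (gradient F (w s)) (u s))
      (transverseCoord (hessian F (w t) (j3 (gradient F (w t)))) (u t)
        + transverseCoord (gradient F (w t)) (j3 (hessian F (w t) (u t)))) t :=
  hasDerivAt_transverseCoord (hasDerivAt_gradient_trajectory hF hw ht) (hu t ht).2

theorem isContinuousArgumentOn_transverse_iff {θ : ℝ → ℝ} (h : ∀ t ∈ I, gradient F (w t) ≠ 0) :
    IsContinuousArgumentOn (transverse F w u) θ I ↔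
      IsContinuousArgumentOn (fun t => transverseCoord (gradient F (w t)) (u t)) θ I := by
  have hpos (t) (ht : t ∈ I) : 0 < ‖gradient F (w t)‖ := norm_pos_iff.2 (h t ht)
  refine ⟨fun hθ => ?_, fun hθ => ?_⟩
  · refine (hθ.ofReal_mul hpos).congr_curve fun t ht => ?_
    rw [transverse_eq, ← mul_assoc, ← Complex.ofReal_mul, mul_inv_cancel₀ (hpos t ht).ne',
      Complex.ofReal_one, one_mul]
  · exact (hθ.ofReal_mul fun t ht => inv_pos.2 (hpos t ht)).congr_curve fun t _ =>
      (transverse_eq F w u t).symm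

theorem wedge_deriv_transverseCoord_pos {n u : R4} (B : R4 →ₗ[ℝ] R4)
    (hB : ∀ v, inner ℝ n v = 0 → 0 ≤ inner ℝ (B v) v) (hflow : 0 < inner ℝ (B (j3 n)) (j3 n))
    (hu : inner ℝ n u = 0) (hne : transverseCoord n u ≠ 0) :
    0 < wedge (transverseCoord n u)
      (transverseCoord (B (j3 n)) u + transverseCoord n (j3 (B u))) := by
  refine pos_of_mul_pos_right ?_ (sq_nonneg ‖n‖)
  rw [rotation_identity B hu]
  refine add_pos_of_nonneg_of_pos (hB _ ?_) (mul_pos (Complex.normSq_pos.2 hne) hflow)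
  simp only [inner_R4, j1, j2, PiLp.add_apply, PiLp.smul_apply, smul_eq_mul, Matrix.cons_val]
  ring

theorem exists_hasDerivAt_argument_pos {θ : ℝ → ℝ} (hF : Differentiable ℝ (gradient F))
    (hw : IsTrajectoryOn F w I) (h0 : ∀ s ∈ I, gradient F (w s) ≠ 0) (hI : I ∈ 𝓝 t)
    (hB : ∀ v, inner ℝ (gradient F (w t)) v = 0 → 0 ≤ inner ℝ (hessian F (w t) v) v)
    (hflow : 0 < inner ℝ (hessian F (w t) (j3 (gradient F (w t)))) (j3 (gradient F (w t))))
    (hu : IsLinearizedSolutionOn F w u I)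
    (hθ : IsContinuousArgumentOn (transverse F w u) θ I) : ∃ θ' > 0, HasDerivAt θ θ' t := by
  have ht := mem_of_mem_nhds hI
  rw [isContinuousArgumentOn_transverse_iff h0] at hθ
  have hne := hθ.ne_zero ht
  exact ⟨_, div_pos (wedge_deriv_transverseCoord_pos (hessian F (w t) : R4 →ₗ[ℝ] R4) hB hflow
    (hu t ht).1 hne) (Complex.normSq_pos.2 hne),
    hθ.hasDerivAt hI (hasDerivAt_transverseCoord_linearized hF hw hu ht)⟩

theorem IsLinearizedSolutionOn.combination {u₁ u₂ : ℝ → R4} (h₁ : IsLinearizedSolutionOn F w u₁ I)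
    (h₂ : IsLinearizedSolutionOn F w u₂ I) (x y : ℝ) :
    IsLinearizedSolutionOn F w (fun t => x • u₁ t + y • u₂ t) I := by
  intro t ht
  refine ⟨?_, (((h₁ t ht).2.const_smul x).add ((h₂ t ht).2.const_smul y)).congr_deriv ?_⟩
  · rw [inner_add_right, inner_smul_right, inner_smul_right, (h₁ t ht).1, (h₂ t ht).1,
      mul_zero, mul_zero, add_zero]
  · rw [map_add, map_smul, map_smul]
    exact ((j3L.map_add _ _).trans (congrArg₂ _ (j3L.map_smul x _) (j3L.map_smul y _))).symm

theorem transverseCoord_combination (n u v : R4) (x y : ℝ) :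
    transverseCoord n (x • u + y • v) = x * transverseCoord n u + y * transverseCoord n v := by
  apply Complex.ext <;> simp [transverseCoord, inner_add_right, inner_smul_right]

theorem IsLinearizedSolutionOn.omega0_eq (hF : ContDiff ℝ 2 F) {v : ℝ → R4}
    (hu : IsLinearizedSolutionOn F w u univ) (hv : IsLinearizedSolutionOn F w v univ) (s t : ℝ) :
    omega0 (u s) (v s) = omega0 (u t) (v t) :=
  omega0_eq_omega0_of_hasDerivAt (fun t => isSymmetric_fderiv_gradient hF (w t))
    (fun t => (hu t (mem_univ t)).2) (fun t => (hv t (mem_univ t)).2) s t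

theorem wedge_mul_eq {z z₁ z₂ : ℂ} :
    (wedge z₁ z₂ : ℂ) * z = wedge z z₂ * z₁ + wedge z₁ z * z₂ := by
  apply Complex.ext <;> simp only [wedge, Complex.mul_re, Complex.mul_im, Complex.add_re,
    Complex.add_im, Complex.ofReal_re, Complex.ofReal_im] <;> ring

theorem rotationSet_eq_planeRotationSet (hF : ContDiff ℝ 2 F)
    (h0 : ∀ t, gradient F (w t) ≠ 0) {u₁ u₂ : ℝ → R4} (h₁ : IsLinearizedSolutionOn F w u₁ univ)
    (h₂ : IsLinearizedSolutionOn F w u₂ univ) (hω : 0 < omega0 (u₁ 0) (u₂ 0)) (T : ℝ) :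
    rotationSet F w T =
      planeRotationSet (fun t => transverseCoord (gradient F (w t)) (u₁ t))
        (fun t => transverseCoord (gradient F (w t)) (u₂ t)) T := by
  have hiff (u θ) := isContinuousArgumentOn_transverse_iff (F := F) (w := w) (u := u) (θ := θ)
    (I := univ) fun t _ => h0 t
  refine Subset.antisymm ?_ ?_
  · rintro _ ⟨u, θ, hu, hθ, rfl⟩
    refine ⟨omega0 (u 0) (u₂ 0), omega0 (u₁ 0) (u 0), θ, ?_, rfl⟩
    refine (((hiff u θ).1 hθ).ofReal_mul fun _ _ => hω).congr_curve fun t _ => ?_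
    have hsq : (‖gradient F (w t)‖ ^ 2 : ℂ) ≠ 0 := by
      exact_mod_cast (pow_pos (norm_pos_iff.2 (h0 t)) 2).ne'
    have hcramer := wedge_mul_eq (z := transverseCoord (gradient F (w t)) (u t))
      (z₁ := transverseCoord (gradient F (w t)) (u₁ t))
      (z₂ := transverseCoord (gradient F (w t)) (u₂ t))
    have ht := mem_univ t
    rw [wedge_transverseCoord (h₁ t ht).1 (h₂ t ht).1,
      wedge_transverseCoord (hu t ht).1 (h₂ t ht).1,
      wedge_transverseCoord (h₁ t ht).1 (hu t ht).1, h₁.omega0_eq hF h₂ t 0,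
      hu.omega0_eq hF h₂ t 0, h₁.omega0_eq hF hu t 0] at hcramer
    push_cast at hcramer
    exact mul_left_cancel₀ hsq (by linear_combination hcramer)
  · rintro _ ⟨x, y, θ, hθ, rfl⟩
    refine ⟨_, θ, h₁.combination h₂ x y, (hiff _ θ).2 ?_, rfl⟩
    exact hθ.congr_curve fun t _ => (transverseCoord_combination _ _ _ x y).symm

theorem exists_rotationSet_eq_Icc (hF : ContDiff ℝ 2 F) (hw : IsTrajectoryOn F w univ)
    (h0 : ∀ t, gradient F (w t) ≠ 0) (T : ℝ) :
    ∃ a b : ℝ, a ≤ b ∧ b < a + 1 / 2 ∧ rotationSet F w T = Icc a b := by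
  set n := gradient F (w 0)
  obtain ⟨u₁, h₁, hu₁⟩ := exists_linearizedSolution hF hw (v := j1 n)
    (by simp only [inner_R4, j1, Matrix.cons_val]; ring)
  obtain ⟨u₂, h₂, hu₂⟩ := exists_linearizedSolution hF hw (v := j2 n)
    (by simp only [inner_R4, j2, Matrix.cons_val]; ring)
  have hω : 0 < omega0 (u₁ 0) (u₂ 0) := by
    have : omega0 (j1 n) (j2 n) = ‖n‖ ^ 2 := by
      simp only [norm_sq_R4, omega0, j1, j2, Matrix.cons_val]
      ring
    rw [hu₁, hu₂, this]
    exact pow_pos (norm_pos_iff.2 (h0 0)) 2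
  have hgrad : Continuous fun t => gradient F (w t) :=
    (contDiff_one_gradient hF).continuous.comp hw.continuous
  rw [rotationSet_eq_planeRotationSet hF h0 h₁ h₂ hω]
  refine exists_planeRotationSet_eq_Icc (continuous_transverseCoord hgrad h₁.continuous)
    (continuous_transverseCoord hgrad h₂.continuous) (fun t => ?_) T
  rw [wedge_transverseCoord (h₁ t (mem_univ t)).1 (h₂ t (mem_univ t)).1, h₁.omega0_eq hF h₂ t 0]
  exact (mul_pos (pow_pos (norm_pos_iff.2 (h0 t)) 2) hω).ne'

end Linearized

/-! ### The index of an interval of rotation numbers -/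

section Index

variable {F : R4 → ℝ} {w : ℝ → R4} {T a b : ℝ}

theorem hasIndex_iff_of_rotationSet_eq_Icc (hab : a ≤ b) (hI : rotationSet F w T = Icc a b)
    {μ : ℤ} : HasIndex F w T μ ↔ ∀ᶠ ε in 𝓝[>] (0 : ℝ), ∃ k : ℤ,
      (μ = 2 * k + 1 ∧ (k : ℝ) < a - ε ∧ b - ε < k + 1) ∨
      (μ = 2 * k ∧ a - ε < k ∧ k < b - ε) := by
  refine eventually_congr (Eventually.of_forall fun ε => exists_congr fun k => ?_)
  rw [hI, image_sub_const_Icc, interior_Icc, mem_Ioo, Icc_subset_Ioo_iff (by linarith)]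

theorem existsUnique_hasIndex (hab : a ≤ b) (hlen : b < a + 1)
    (hI : rotationSet F w T = Icc a b) : ∃! μ : ℤ, HasIndex F w T μ := by
  simp only [hasIndex_iff_of_rotationSet_eq_Icc hab hI]
  refine existsUnique_of_exists_of_unique ?_ fun μ ν hμ hν => ?_
  · have hk : ((⌈b⌉ - 1 : ℤ) : ℝ) < b ∧ b ≤ (⌈b⌉ - 1 : ℤ) + 1 := by
      push_cast; constructor <;> linarith [Int.ceil_lt_add_one b, Int.le_ceil b]
    generalize ⌈b⌉ - 1 = k at hk
    rcases lt_or_ge (k : ℝ) a with ha | ha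
    · refine ⟨2 * k + 1, ?_⟩
      filter_upwards [Ioo_mem_nhdsGT (sub_pos.2 ha)] with ε hε
      exact ⟨k, Or.inl ⟨rfl, by linarith [hε.2], by linarith [hε.1]⟩⟩
    · refine ⟨2 * k, ?_⟩
      filter_upwards [Ioo_mem_nhdsGT (sub_pos.2 hk.1)] with ε hε
      exact ⟨k, Or.inr ⟨rfl, by linarith [hε.1], by linarith [hε.2]⟩⟩
  · obtain ⟨ε, ⟨m, hm⟩, ⟨n, hn⟩⟩ := (hμ.and hν).exists
    have lt_of_cast {p q : ℤ} (h : (p : ℝ) < q) : p < q := by exact_mod_cast h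
    have le_of_cast {p q : ℤ} (h : (p : ℝ) < q + 1) : p ≤ q :=
      Int.lt_add_one_iff.1 (by exact_mod_cast h)
    rcases hm with ⟨rfl, h1, h2⟩ | ⟨rfl, h1, h2⟩ <;> rcases hn with ⟨rfl, h3, h4⟩ | ⟨rfl, h3, h4⟩
    · rw [le_antisymm (le_of_cast (p := m) (q := n) (by linarith)) (le_of_cast (by linarith))]
    · exact absurd (le_of_cast (p := n) (q := m) (by linarith))
        (lt_of_cast (by linarith)).not_ge
    · exact absurd (le_of_cast (p := m) (q := n) (by linarith))
        (lt_of_cast (by linarith)).not_ge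
    · rw [le_antisymm (le_of_cast (p := m) (q := n) (by linarith)) (le_of_cast (by linarith))]

theorem two_mul_add_one_le_of_hasIndex {m μ : ℤ} (hab : a ≤ b)
    (hI : rotationSet F w T = Icc a b) (ha : m < a) (hμ : HasIndex F w T μ) : 2 * m + 1 ≤ μ := by
  rw [hasIndex_iff_of_rotationSet_eq_Icc hab hI] at hμ
  obtain ⟨ε, ⟨k, hk⟩, hε⟩ := (hμ.and (Ioo_mem_nhdsGT (sub_pos.2 ha))).exists
  rcases hk with ⟨rfl, -, hupper⟩ | ⟨rfl, hlower, -⟩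
  · have : m < k + 1 := by exact_mod_cast (show (m : ℝ) < k + 1 by linarith [hε.2])
    omega
  · have : m < k := by exact_mod_cast (show (m : ℝ) < k by linarith [hε.2])
    omega

end Index

/-! ### Jacobi fields and Riccati forms in the plane -/

theorem inner_R2 (a b : R2) : inner ℝ a b = a 0 * b 0 + a 1 * b 1 := by
  simp [PiLp.inner_apply, Fin.sum_univ_two, mul_comm]

theorem norm_sq_R2 (a : R2) : ‖a‖ ^ 2 = a 0 ^ 2 + a 1 ^ 2 := by
  rw [← real_inner_self_eq_norm_sq, inner_R2]
  ring

/-- The oriented area of the parallelogram spanned by two vectors of the plane. -/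
def area (a b : R2) : ℝ := a 0 * b 1 - a 1 * b 0

theorem area_swap (a b : R2) : area a b = -area b a := by
  simp only [area]; ring

theorem area_self (a : R2) : area a a = 0 := by
  simp only [area]; ring

theorem area_zero_left (a : R2) : area 0 a = 0 := by
  simp [area]

theorem area_smul_smul (r s : ℝ) (a b : R2) : area (r • a) (s • b) = r * s * area a b := by
  simp only [area, PiLp.smul_apply, smul_eq_mul]; ring

theorem continuous_area : Continuous fun p : R2 × R2 => area p.1 p.2 := by
  simp only [area]; fun_prop

theorem hasDerivAt_area {a b : ℝ → R2} {a' b' : R2} {t : ℝ} (ha : HasDerivAt a a' t)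
    (hb : HasDerivAt b b' t) :
    HasDerivAt (fun s => area (a s) (b s)) (area a' (b t) + area (a t) b') t := by
  rw [hasDerivAt_euclidean] at ha hb
  refine (((ha 0).mul (hb 1)).sub ((ha 1).mul (hb 0))).congr_deriv ?_
  simp only [area]
  ring

theorem area_smul_cyclic (a b c : R2) : area a b • c = area c b • a + area a c • b := by
  ext i; fin_cases i <;> simp only [area, PiLp.add_apply, PiLp.smul_apply, smul_eq_mul,
    Fin.zero_eta, Fin.mk_one] <;> ring

theorem norm_sq_mul_area (a b c : R2) :
    ‖a‖ ^ 2 * area b c = inner ℝ a b * area a c - area a b * inner ℝ a c := by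
  simp only [norm_sq_R2, area, inner_R2]
  ring

theorem norm_sq_mul_inner (a b c : R2) :
    ‖a‖ ^ 2 * inner ℝ b c = inner ℝ a b * inner ℝ a c + area a b * area a c := by
  simp only [norm_sq_R2, area, inner_R2]
  ring

theorem eq_zero_of_inner_area_eq_zero {a b : R2} (ha : a ≠ 0) (h : inner ℝ a b = 0)
    (h' : area a b = 0) : b = 0 := by
  have := norm_sq_mul_inner a b b
  rw [h, h', zero_mul, add_zero, real_inner_self_eq_norm_sq] at this
  exact norm_eq_zero.1 (pow_eq_zero_iff two_ne_zero |>.1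
    ((mul_eq_zero.1 this).resolve_left (pow_pos (norm_pos_iff.2 ha) 2).ne'))

/-- `v` solves the Jacobi equation `v̈ = -B v` in the plane, with velocity `v'`. -/
structure IsJacobiField (B : ℝ → R2 →L[ℝ] R2) (v v' : ℝ → R2) : Prop where
  deriv_position : ∀ t, HasDerivAt v (v' t) t
  deriv_velocity : ∀ t, HasDerivAt v' (-B t (v t)) t

/-- Two Jacobi fields `(y, g)` and `(ξ, η)` with vanishing symplectic product. Where `y` and `ξ` are
independent they span the graph `{(v, R v)}` of a symmetric matrix `R`, which solves the Riccati
equation `Ṙ = -B - R²`. -/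
structure LagrangianPair (B : ℝ → R2 →L[ℝ] R2) (y g ξ η : ℝ → R2) : Prop where
  left : IsJacobiField B y g
  right : IsJacobiField B ξ η
  symplectic : ∀ t, inner ℝ (y t) (η t) = inner ℝ (g t) (ξ t)

/-- The vector `area y ξ • R X`, where `R` is the matrix with `R y = g` and `R ξ = η`. -/
def scaledRiccati (y g ξ η X : R2) : R2 := area y X • η - area ξ X • g

/-- The quadratic form `⟪R X, X⟫` of the matrix `R` with `R y = g` and `R ξ = η`, corrected by a
term that absorbs the derivative of a test field with `Ẋ = κ y`. It is junk where
`area y ξ = 0`. -/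
def riccati (κ : ℝ) (y g ξ η X : R2) : ℝ :=
  inner ℝ (scaledRiccati y g ξ η X) X / area y ξ - 2 * κ * inner ℝ y X

section PlaneAlgebra

variable {y g ξ η : R2}

theorem inner_scaledRiccati_comm (h : inner ℝ y η = inner ℝ g ξ) (X Z : R2) :
    inner ℝ (scaledRiccati y g ξ η X) Z = inner ℝ X (scaledRiccati y g ξ η Z) := by
  simp only [inner_R2, scaledRiccati, area, PiLp.sub_apply, PiLp.smul_apply, smul_eq_mul] at h ⊢
  linear_combination (X 1 * Z 0 - X 0 * Z 1) * h

/-- The Cayley–Hamilton theorem for `R`. -/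
theorem scaledRiccati_scaledRiccati (y g ξ η X : R2) :
    scaledRiccati y g ξ η (scaledRiccati y g ξ η X) =
      (area g ξ + area y η) • scaledRiccati y g ξ η X - (area y ξ * area g η) • X := by
  ext i; fin_cases i <;> simp only [scaledRiccati, area, PiLp.sub_apply, PiLp.smul_apply,
    smul_eq_mul, Fin.zero_eta, Fin.mk_one] <;> ring

theorem norm_sq_scaledRiccati (h : inner ℝ y η = inner ℝ g ξ) (X : R2) :
    ‖scaledRiccati y g ξ η X‖ ^ 2 =
      (area g ξ + area y η) * inner ℝ (scaledRiccati y g ξ η X) X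
        - area y ξ * area g η * ‖X‖ ^ 2 := by
  rw [← real_inner_self_eq_norm_sq, ← inner_scaledRiccati_comm h, scaledRiccati_scaledRiccati,
    inner_sub_left, inner_smul_left, inner_smul_left, real_inner_self_eq_norm_sq]
  rfl

theorem inner_scaledRiccati_left (h : inner ℝ y η = inner ℝ g ξ) (X : R2) :
    inner ℝ (scaledRiccati y g ξ η X) y = area y ξ * inner ℝ g X := by
  rw [inner_scaledRiccati_comm h, scaledRiccati, area_self, zero_smul, zero_sub, inner_neg_right,
    inner_smul_right, area_swap, real_inner_comm X]
  ring

theorem norm_sq_mul_area_velocities (h : inner ℝ y η = inner ℝ g ξ) :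
    ‖y‖ ^ 2 * area g η = inner ℝ g y * (area g ξ + area y η) - ‖g‖ ^ 2 * area y ξ := by
  rw [norm_sq_mul_area, h, norm_sq_mul_area g y ξ, area_swap y g, real_inner_comm y g]
  ring

end PlaneAlgebra

namespace LagrangianPair

variable {B : ℝ → R2 →L[ℝ] R2} {y g ξ η X : ℝ → R2} {κ t : ℝ}

theorem hasDerivAt_area (h : LagrangianPair B y g ξ η) (t : ℝ) :
    HasDerivAt (fun s => area (y s) (ξ s)) (area (g t) (ξ t) + area (y t) (η t)) t :=
  HenonHeiles.hasDerivAt_area (h.left.deriv_position t) (h.right.deriv_position t)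

theorem hasDerivAt_scaledRiccati (h : LagrangianPair B y g ξ η) (hX : HasDerivAt X (κ • y t) t) :
    HasDerivAt (fun s => inner ℝ (scaledRiccati (y s) (g s) (ξ s) (η s) (X s)) (X s))
      (area (g t) (η t) * ‖X t‖ ^ 2
        - area (y t) (ξ t) * (inner ℝ (B t (X t)) (X t) - 2 * κ * inner ℝ (g t) (X t))) t := by
  have hy := h.left.deriv_position t
  have hg := h.left.deriv_velocity t
  have hξ := h.right.deriv_position t
  have hη := h.right.deriv_velocity t
  have hBX : area (y t) (ξ t) * inner ℝ (B t (X t)) (X t) =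
      area (X t) (ξ t) * inner ℝ (B t (y t)) (X t)
        + area (y t) (X t) * inner ℝ (B t (ξ t)) (X t) := by
    have := congr(inner ℝ (B t $(area_smul_cyclic (y t) (ξ t) (X t))) (X t))
    simpa only [map_add, map_smul, inner_add_left, inner_smul_left, conj_trivial] using this
  have hsymp := h.symplectic t
  have hN : HasDerivAt (fun s => scaledRiccati (y s) (g s) (ξ s) (η s) (X s))
      (area (y t) (X t) • -B t (ξ t) + (area (g t) (X t) + area (y t) (κ • y t)) • η t
        - (area (ξ t) (X t) • -B t (y t) + (area (η t) (X t) + area (ξ t) (κ • y t)) • g t)) t :=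
    ((HenonHeiles.hasDerivAt_area hy hX).smul hη).sub ((HenonHeiles.hasDerivAt_area hξ hX).smul hg)
  refine (hN.inner ℝ hX).congr_deriv ?_
  rw [scaledRiccati]
  generalize B t (y t) = By at *
  generalize B t (ξ t) = Bξ at *
  generalize B t (X t) = BX at *
  simp only [inner_R2, area, norm_sq_R2, PiLp.sub_apply, PiLp.add_apply, PiLp.neg_apply,
    PiLp.smul_apply, smul_eq_mul] at *
  linear_combination hBX + κ * (y t 0 * X t 1 - y t 1 * X t 0) * hsymp

theorem hasDerivAt_riccati (h : LagrangianPair B y g ξ η) (hX : HasDerivAt X (κ • y t) t)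
    (hJ : area (y t) (ξ t) ≠ 0) :
    HasDerivAt (fun s => riccati κ (y s) (g s) (ξ s) (η s) (X s))
      (-(inner ℝ (B t (X t)) (X t)
        + ‖scaledRiccati (y t) (g t) (ξ t) (η t) (X t)‖ ^ 2 / area (y t) (ξ t) ^ 2
        + 2 * κ ^ 2 * ‖y t‖ ^ 2)) t := by
  refine (((h.hasDerivAt_scaledRiccati hX).div (h.hasDerivAt_area t) hJ).sub
    (((h.left.deriv_position t).inner ℝ hX).const_mul (2 * κ))).congr_deriv ?_
  rw [norm_sq_scaledRiccati (h.symplectic t), inner_smul_right, real_inner_self_eq_norm_sq]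
  field_simp
  ring

theorem exists_hasDerivAt_riccati_neg (h : LagrangianPair B y g ξ η)
    (hX : HasDerivAt X (κ • y t) t) (hJ : area (y t) (ξ t) ≠ 0)
    (hpos : ∀ v ≠ 0, 0 < ‖y t‖ ^ 2 * inner ℝ (B t v) v + inner ℝ (g t) v ^ 2)
    (hne : κ ≠ 0 ∨ X t ≠ 0) :
    ∃ d < 0, HasDerivAt (fun s => riccati κ (y s) (g s) (ξ s) (η s) (X s)) d t := by
  refine ⟨_, ?_, h.hasDerivAt_riccati hX hJ⟩
  have hy : 0 < ‖y t‖ ^ 2 := pow_pos (norm_pos_iff.2 fun h0 => hJ (by rw [h0, area_zero_left])) 2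
  set N := scaledRiccati (y t) (g t) (ξ t) (η t) (X t)
  -- Cauchy–Schwarz for `R X` and `y`, since `⟪R X, y⟫ = ⟪X, R y⟫ = ⟪g, X⟫`.
  have hCS : inner ℝ (g t) (X t) ^ 2 ≤ ‖y t‖ ^ 2 * (‖N‖ ^ 2 / area (y t) (ξ t) ^ 2) := by
    have := real_inner_mul_inner_self_le N (y t)
    rw [inner_scaledRiccati_left (h.symplectic t), real_inner_self_eq_norm_sq,
      real_inner_self_eq_norm_sq] at this
    rw [← mul_div_assoc, le_div_iff₀ (by positivity)]
    linear_combination this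
  have hform : 0 < (‖y t‖ ^ 2 * inner ℝ (B t (X t)) (X t) + inner ℝ (g t) (X t) ^ 2)
      + 2 * κ ^ 2 * (‖y t‖ ^ 2) ^ 2 := by
    by_cases hXt : X t = 0
    · have hκ : κ ≠ 0 := hne.resolve_right (not_not.2 hXt)
      simp only [hXt, inner_zero_right]
      positivity
    · have := hpos (X t) hXt
      positivity
  refine neg_neg_iff_pos.2 (pos_of_mul_pos_right ?_ hy.le)
  linarith

end LagrangianPair

theorem tendsto_div_of_hasDerivAt {f g : ℝ → ℝ} {f' g' t : ℝ} (hf : HasDerivAt f f' t)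
    (hg : HasDerivAt g g' t) (hf0 : f t = 0) (hg0 : g t = 0) (hg' : g' ≠ 0) :
    Tendsto (fun s => f s / g s) (𝓝[≠] t) (𝓝 (f' / g')) := by
  refine ((hasDerivAt_iff_tendsto_slope.1 hf).div (hasDerivAt_iff_tendsto_slope.1 hg) hg').congr' ?_
  filter_upwards [self_mem_nhdsWithin] with s hs
  have : s - t ≠ 0 := sub_ne_zero.2 hs
  simp only [slope_def_field, hf0, hg0, sub_zero, Pi.div_apply]
  field_simp

theorem lt_of_deriv_neg_Ioo {f : ℝ → ℝ} {a b La Lb : ℝ} (hab : a < b)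
    (hf : ∀ t ∈ Ioo a b, ∃ d < 0, HasDerivAt f d t) (ha : Tendsto f (𝓝[≠] a) (𝓝 La))
    (hb : Tendsto f (𝓝[≠] b) (𝓝 Lb)) : Lb < La := by
  have hanti : StrictAntiOn f (Ioo a b) := by
    refine strictAntiOn_of_deriv_neg (convex_Ioo a b) (fun t ht => ?_) fun t ht => ?_
    · obtain ⟨d, -, hd⟩ := hf t ht
      exact hd.continuousAt.continuousWithinAt
    · rw [interior_Ioo] at ht
      obtain ⟨d, hd0, hd⟩ := hf t ht
      rwa [hd.deriv]
  obtain ⟨m, ham, hmb⟩ := exists_between hab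
  obtain ⟨n, hmn, hnb⟩ := exists_between hmb
  have hm : m ∈ Ioo a b := ⟨ham, hmb⟩
  have hn : n ∈ Ioo a b := ⟨ham.trans hmn, hnb⟩
  calc Lb ≤ f n := le_of_tendsto (hb.mono_left (nhdsLT_le_nhdsNE b)) <| by
        filter_upwards [Ioo_mem_nhdsLT hnb] with s hs
        exact (hanti hn ⟨hn.1.trans hs.1, hs.2⟩ hs.1).le
    _ < f m := hanti hm hn hmn
    _ ≤ La := ge_of_tendsto (ha.mono_left (nhdsGT_le_nhdsNE a)) <| by
        filter_upwards [Ioo_mem_nhdsGT ham] with s hs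
        exact (hanti ⟨hs.1, hs.2.trans hmb⟩ hm hs.2).le

theorem exists_eq_smul_of_area_eq_zero {a b : R2} (ha : a ≠ 0) (h : area a b = 0) :
    ∃ c : ℝ, b = c • a := by
  refine ⟨inner ℝ a b / ‖a‖ ^ 2, ?_⟩
  have hsq : ‖a‖ ^ 2 ≠ 0 := (pow_pos (norm_pos_iff.2 ha) 2).ne'
  have hid : ‖a‖ ^ 2 • b = inner ℝ a b • a + area a b • !₂[-a 1, a 0] := by
    ext i
    fin_cases i <;> simp only [norm_sq_R2, inner_R2, area, PiLp.add_apply, PiLp.smul_apply,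
      smul_eq_mul, Fin.zero_eta, Fin.mk_one, Matrix.cons_val] <;> ring
  rw [div_eq_inv_mul, mul_smul, eq_inv_smul_iff₀ hsq, hid, h, zero_smul, add_zero]

theorem inner_scaledRiccati_smul_left (y g ξ η : R2) (c : ℝ) :
    inner ℝ (scaledRiccati y g ξ η (c • y)) (c • y) = area y ξ * (c ^ 2 * inner ℝ g y) := by
  simp only [inner_R2, scaledRiccati, area, PiLp.sub_apply, PiLp.smul_apply, smul_eq_mul]
  ring

namespace LagrangianPair

variable {B : ℝ → R2 →L[ℝ] R2} {y g ξ η X : ℝ → R2} {κ t : ℝ}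

theorem tendsto_riccati_of_simple_zero (h : LagrangianPair B y g ξ η)
    (hX : HasDerivAt X (κ • y t) t) (hJ : area (y t) (ξ t) = 0)
    (hJ' : area (g t) (ξ t) + area (y t) (η t) ≠ 0)
    (hnum : inner ℝ (scaledRiccati (y t) (g t) (ξ t) (η t) (X t)) (X t) = 0) :
    Tendsto (fun s => riccati κ (y s) (g s) (ξ s) (η s) (X s)) (𝓝[≠] t)
      (𝓝 (area (g t) (η t) * ‖X t‖ ^ 2 / (area (g t) (ξ t) + area (y t) (η t))
        - 2 * κ * inner ℝ (y t) (X t))) := by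
  have htail := ((((h.left.deriv_position t).inner ℝ hX).const_mul
    (2 * κ)).continuousAt.tendsto.mono_left nhdsWithin_le_nhds : Tendsto _ (𝓝[≠] t) _)
  refine Tendsto.sub ?_ htail
  simpa only [hJ, zero_mul, sub_zero] using
    tendsto_div_of_hasDerivAt (h.hasDerivAt_scaledRiccati hX) (h.hasDerivAt_area t) hnum hJ hJ'

theorem tendsto_riccati_of_tangent (h : LagrangianPair B y g ξ η)
    (hX : HasDerivAt X (κ • y t) t) (hy : y t ≠ 0) (htan : area (y t) (X t) = 0)
    (hJ' : area (y t) (ξ t) = 0 → area (g t) (ξ t) + area (y t) (η t) ≠ 0) :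
    Tendsto (fun s => riccati κ (y s) (g s) (ξ s) (η s) (X s)) (𝓝[≠] t)
      (𝓝 (inner ℝ (g t) (y t) * ‖X t‖ ^ 2 / ‖y t‖ ^ 2 - 2 * κ * inner ℝ (y t) (X t))) := by
  obtain ⟨c, hc⟩ := exists_eq_smul_of_area_eq_zero hy htan
  have hy2 : ‖y t‖ ^ 2 ≠ 0 := (pow_pos (norm_pos_iff.2 hy) 2).ne'
  have hnum := inner_scaledRiccati_smul_left (y t) (g t) (ξ t) (η t) c
  rw [← hc] at hnum
  have hX2 : ‖X t‖ ^ 2 = c ^ 2 * ‖y t‖ ^ 2 := by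
    rw [hc, norm_smul, mul_pow, Real.norm_eq_abs, sq_abs]
  by_cases hJ : area (y t) (ξ t) = 0
  · convert h.tendsto_riccati_of_simple_zero hX hJ (hJ' hJ) (by rw [hnum, hJ, zero_mul]) using 3
    rw [div_eq_div_iff hy2 (hJ' hJ)]
    have := norm_sq_mul_area_velocities (h.symplectic t)
    rw [hJ, mul_zero, sub_zero] at this
    linear_combination -‖X t‖ ^ 2 * this
  · convert ((h.hasDerivAt_riccati hX hJ).continuousAt.tendsto.mono_left
      nhdsWithin_le_nhds : Tendsto _ (𝓝[≠] t) _) using 2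
    rw [riccati, hnum, mul_div_cancel_left₀ _ hJ, hX2, ← mul_assoc, mul_div_cancel_right₀ _ hy2,
      mul_comm (c ^ 2)]

theorem tendsto_riccati_of_brake (h : LagrangianPair B y g ξ η)
    (hX : HasDerivAt X (κ • y t) t) (hy : y t = 0) (hg : inner ℝ (g t) (X t) = 0)
    (hJ' : area (g t) (ξ t) ≠ 0) :
    Tendsto (fun s => riccati κ (y s) (g s) (ξ s) (η s) (X s)) (𝓝[≠] t)
      (𝓝 (‖X t‖ ^ 2 * (area (g t) (η t) / area (g t) (ξ t)))) := by
  convert h.tendsto_riccati_of_simple_zero hX (by rw [hy, area_zero_left])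
    (by rwa [hy, area_zero_left, add_zero])
    (by rw [hy, scaledRiccati, area_zero_left, zero_smul, zero_sub, inner_neg_left,
      inner_smul_left, hg, mul_zero, neg_zero]) using 2
  rw [hy, area_zero_left, inner_zero_left]
  ring

theorem tendsto_riccati_of_brake_of_field_eq_zero (h : LagrangianPair B y g ξ η)
    (hX : HasDerivAt X (κ • y t) t) (hy : y t = 0) (hX0 : X t = 0) (hg : g t ≠ 0)
    (hne : area (g t) (ξ t) = 0 → area (g t) (η t) ≠ 0) :
    Tendsto (fun s => riccati κ (y s) (g s) (ξ s) (η s) (X s)) (𝓝[≠] t) (𝓝 0) := by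
  by_cases hJ' : area (g t) (ξ t) = 0
  swap
  · simpa [hX0] using h.tendsto_riccati_of_brake hX hy (by rw [hX0, inner_zero_right]) hJ'
  have hξ0 : ξ t = 0 := eq_zero_of_inner_area_eq_zero hg
    (by rw [← h.symplectic t, hy, inner_zero_left]) hJ'
  have harea {a b : ℝ → R2} {a' b' : R2} (ha : Tendsto a (𝓝[≠] t) (𝓝 a'))
      (hb : Tendsto b (𝓝[≠] t) (𝓝 b')) :
      Tendsto (fun s => area (a s) (b s)) (𝓝[≠] t) (𝓝 (area a' b')) :=
    (continuous_area.tendsto (a', b')).comp (ha.prodMk_nhds hb)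
  have hlim {a : ℝ → R2} {a' : R2} (ha : HasDerivAt a a' t) : Tendsto a (𝓝[≠] t) (𝓝 (a t)) :=
    ha.continuousAt.tendsto.mono_left nhdsWithin_le_nhds
  -- The quotient is unchanged when `y`, `ξ` and one factor `X` are divided by `s - t`.
  have hys := hasDerivAt_iff_tendsto_slope.1 (h.left.deriv_position t)
  have hξs := hasDerivAt_iff_tendsto_slope.1 (h.right.deriv_position t)
  have hXs := hasDerivAt_iff_tendsto_slope.1 hX
  have hnum := Tendsto.inner (𝕜 := ℝ) (((harea hys hXs).smul (hlim (h.right.deriv_velocity t))).sub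
    ((harea hξs hXs).smul (hlim (h.left.deriv_velocity t)))) (hlim hX)
  have hriccati := (hnum.div (harea hys hξs) (hne hJ')).sub
    (((hlim (h.left.deriv_position t)).inner (hlim hX)).const_mul (2 * κ))
  simp only [hX0, inner_zero_right, zero_div, mul_zero, sub_zero] at hriccati
  refine hriccati.congr' ?_
  filter_upwards [self_mem_nhdsWithin] with s hs
  have hst : s - t ≠ 0 := sub_ne_zero.2 hs
  simp only [riccati, scaledRiccati, Pi.div_apply, slope, vsub_eq_sub, hy, hX0, hξ0, sub_zero,
    area_smul_smul, inner_sub_left, inner_smul_left, conj_trivial, mul_assoc, ← mul_sub]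
  rw [mul_div_mul_left _ _ (inv_ne_zero hst), mul_div_mul_left _ _ (inv_ne_zero hst)]

end LagrangianPair

theorem exists_inner_add_smul_eq_zero (p q x₁ x₂ : R2) : ∃ (v : R2) (κ : ℝ), (κ ≠ 0 ∨ v ≠ 0) ∧
    inner ℝ p (v + κ • x₁) = 0 ∧ inner ℝ q (v + κ • x₂) = 0 := by
  let f : R2 × ℝ →ₗ[ℝ] ℝ × ℝ :=
    ((innerₗ R2 p).coprod (LinearMap.toSpanSingleton ℝ ℝ (inner ℝ p x₁))).prod
      ((innerₗ R2 q).coprod (LinearMap.toSpanSingleton ℝ ℝ (inner ℝ q x₂)))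
  obtain ⟨⟨v, κ⟩, hf, hne⟩ := (Submodule.ne_bot_iff _).1
    (LinearMap.ker_ne_bot_of_finrank_lt (f := f) (by simp))
  refine ⟨v, κ, ?_, ?_, ?_⟩
  · contrapose! hne
    rw [hne.1, hne.2, Prod.mk_zero_zero]
  · simpa [inner_add_right, inner_smul_right, f] using congr($(LinearMap.mem_ker.1 hf).1)
  · simpa [inner_add_right, inner_smul_right, f] using congr($(LinearMap.mem_ker.1 hf).2)

theorem exists_inner_scaledRiccati_eq_zero {y g ξ η : R2} (hJ : area y ξ = 0) :
    ∃ q : R2, ∀ X, inner ℝ q X = 0 → inner ℝ (scaledRiccati y g ξ η X) X = 0 := by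
  by_cases hy : y = 0
  · refine ⟨g, fun X hX => ?_⟩
    rw [hy, scaledRiccati, area_zero_left, zero_smul, zero_sub, inner_neg_left, inner_smul_left, hX,
      mul_zero, neg_zero]
  · refine ⟨!₂[-y 1, y 0], fun X hX => ?_⟩
    have hXy : area y X = 0 := by
      simp only [inner_R2, Matrix.cons_val] at hX
      rw [area]
      linarith
    obtain ⟨c, rfl⟩ := exists_eq_smul_of_area_eq_zero hy hXy
    rw [inner_scaledRiccati_smul_left, hJ, zero_mul]

/-- A Lagrangian pair along a curve `x` in a convex potential: `y` and `g` are the velocity and the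
force, and the last field says that the energy surface is positively curved where `y ≠ 0`. -/
structure ConvexPair (B : ℝ → R2 →L[ℝ] R2) (x y g ξ η : ℝ → R2) : Prop
    extends LagrangianPair B y g ξ η where
  deriv_curve : ∀ t, HasDerivAt x (y t) t
  force_ne_zero : ∀ t, y t = 0 → g t ≠ 0
  convex : ∀ t, y t ≠ 0 → ∀ v ≠ 0, 0 < ‖y t‖ ^ 2 * inner ℝ (B t v) v + inner ℝ (g t) v ^ 2

namespace ConvexPair

variable {B : ℝ → R2 →L[ℝ] R2} {x y g ξ η : ℝ → R2} {κ a b s La Lb : ℝ} {v : R2}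

theorem hasDerivAt_testField (h : ConvexPair B x y g ξ η) (v : R2) (κ t : ℝ) :
    HasDerivAt (fun s => v + κ • x s) (κ • y t) t :=
  ((h.deriv_curve t).const_smul κ).const_add v

theorem riccati_limit_lt (h : ConvexPair B x y g ξ η) (hv : κ ≠ 0 ∨ v ≠ 0) (hab : a < b)
    (hJ : ∀ t ∈ Ioo a b, area (y t) (ξ t) ≠ 0)
    (ha : Tendsto (fun s => riccati κ (y s) (g s) (ξ s) (η s) (v + κ • x s)) (𝓝[≠] a) (𝓝 La))
    (hb : Tendsto (fun s => riccati κ (y s) (g s) (ξ s) (η s) (v + κ • x s)) (𝓝[≠] b) (𝓝 Lb)) :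
    Lb < La := by
  refine lt_of_deriv_neg_Ioo hab (fun t ht => ?_) ha hb
  have hy : y t ≠ 0 := fun hy => hJ t ht (by rw [hy, area_zero_left])
  refine h.exists_hasDerivAt_riccati_neg (h.hasDerivAt_testField v κ t) (hJ t ht) (h.convex t hy) ?_
  by_cases hκ : κ = 0
  · simpa [hκ] using hv
  · exact Or.inl hκ

theorem riccati_limit_lt_of_simple_zero (h : ConvexPair B x y g ξ η) (hv : κ ≠ 0 ∨ v ≠ 0)
    (hs : s ∈ Ioo a b) (hJs : area (y s) (ξ s) = 0)
    (hJs' : area (g s) (ξ s) + area (y s) (η s) ≠ 0)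
    (hnum : inner ℝ (scaledRiccati (y s) (g s) (ξ s) (η s) (v + κ • x s)) (v + κ • x s) = 0)
    (hJ : ∀ t ∈ Ioo a b, area (y t) (ξ t) = 0 → t = s)
    (ha : Tendsto (fun s => riccati κ (y s) (g s) (ξ s) (η s) (v + κ • x s)) (𝓝[≠] a) (𝓝 La))
    (hb : Tendsto (fun s => riccati κ (y s) (g s) (ξ s) (η s) (v + κ • x s)) (𝓝[≠] b) (𝓝 Lb)) :
    Lb < La := by
  have hlim := h.tendsto_riccati_of_simple_zero (h.hasDerivAt_testField v κ s) hJs hJs' hnum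
  have hleft := h.riccati_limit_lt hv hs.1
    (fun t ht ht0 => ht.2.ne (hJ t ⟨ht.1, ht.2.trans hs.2⟩ ht0)) ha hlim
  have hright := h.riccati_limit_lt hv hs.2
    (fun t ht ht0 => ht.1.ne' (hJ t ⟨hs.1.trans ht.1, ht.2⟩ ht0)) hlim hb
  exact hright.trans hleft

theorem exists_testField_riccati_limit_lt (h : ConvexPair B x y g ξ η) (hab : a < b)
    (huniq : {t ∈ Ioo a b | area (y t) (ξ t) = 0}.Subsingleton)
    (hsimple : ∀ t ∈ Ioo a b, area (y t) (ξ t) = 0 → area (g t) (ξ t) + area (y t) (η t) ≠ 0)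
    (p : R2) :
    ∃ (v : R2) (κ : ℝ), inner ℝ p (v + κ • x a) = 0 ∧ ∀ La Lb : ℝ,
      Tendsto (fun s => riccati κ (y s) (g s) (ξ s) (η s) (v + κ • x s)) (𝓝[≠] a) (𝓝 La) →
      Tendsto (fun s => riccati κ (y s) (g s) (ξ s) (η s) (v + κ • x s)) (𝓝[≠] b) (𝓝 Lb) →
      Lb < La := by
  by_cases hzero : ∃ s ∈ Ioo a b, area (y s) (ξ s) = 0
  · obtain ⟨s, hs, hJs⟩ := hzero
    obtain ⟨q, hq⟩ := exists_inner_scaledRiccati_eq_zero (g := g s) (η := η s) hJs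
    obtain ⟨v, κ, hv, hp, hqv⟩ := exists_inner_add_smul_eq_zero p q (x a) (x s)
    exact ⟨v, κ, hp, fun _ _ => h.riccati_limit_lt_of_simple_zero hv hs hJs (hsimple s hs hJs)
      (hq _ hqv) fun t ht ht0 => huniq ⟨ht, ht0⟩ ⟨hs, hJs⟩⟩
  · obtain ⟨v, κ, hv, hp, -⟩ := exists_inner_add_smul_eq_zero p p (x a) (x a)
    exact ⟨v, κ, hp, fun _ _ => h.riccati_limit_lt hv hab fun t ht ht0 => hzero ⟨t, ht, ht0⟩⟩

end ConvexPair

/-! ### The turn of a Jacobi field over one period -/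

theorem sin_mul_sin_pos {α β : ℝ} {k : ℤ} (hα : α ∈ Ioo (k * Real.pi) ((k + 1) * Real.pi))
    (hβ : β ∈ Ioo (k * Real.pi) ((k + 1) * Real.pi)) : 0 < Real.sin α * Real.sin β := by
  have hpos {γ : ℝ} (hγ : γ ∈ Ioo (k * Real.pi) ((k + 1) * Real.pi)) :
      0 < (-1) ^ k * Real.sin γ := by
    rw [← Real.sin_sub_int_mul_pi]
    exact Real.sin_pos_of_pos_of_lt_pi (by linarith [hγ.1]) (by linarith [hγ.2])
  have hsign : ((-1 : ℝ) ^ k) * (-1) ^ k = 1 := by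
    rw [← mul_zpow, neg_one_mul, neg_neg, one_zpow]
  calc 0 < ((-1) ^ k * Real.sin α) * ((-1) ^ k * Real.sin β) := mul_pos (hpos hα) (hpos hβ)
    _ = Real.sin α * Real.sin β := by rw [mul_mul_mul_comm, hsign, one_mul]

/-- If `sin θ` vanishes twice between `a` and `t` then `θ` has increased by more than `π`; an
increase of at most `2π` then leaves `θ t - 2π` and `θ a` between the same multiples of `π`. -/
theorem pi_lt_and_sin_mul_sin_pos {θ : ℝ → ℝ} (hθ : StrictMono θ) {a c₁ c₂ t : ℝ} (hac : a < c₁)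
    (hc : c₁ < c₂) (hct : c₂ < t) (h₁ : Real.sin (θ c₁) = 0) (h₂ : Real.sin (θ c₂) = 0)
    (hle : θ t ≤ θ a + 2 * Real.pi) :
    θ a + Real.pi < θ t ∧ 0 < Real.sin (θ a) * Real.sin (θ t) := by
  obtain ⟨m, hm⟩ := Real.sin_eq_zero_iff.1 h₁
  obtain ⟨n, hn⟩ := Real.sin_eq_zero_iff.1 h₂
  have hθa := hθ hac
  have hθc := hθ hc
  have hθt := hθ hct
  rw [← hm] at hθa
  rw [← hm, ← hn] at hθc
  rw [← hn] at hθt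
  have hmn : (m : ℝ) + 1 ≤ n := by
    exact_mod_cast Int.add_one_le_iff.2 (Int.cast_lt.1 (lt_of_mul_lt_mul_right hθc Real.pi_pos.le))
  have hstep : (m + 1) * Real.pi ≤ n * Real.pi := mul_le_mul_of_nonneg_right hmn Real.pi_pos.le
  refine ⟨by linarith, ?_⟩
  rw [← Real.sin_sub_two_pi (θ t)]
  refine sin_mul_sin_pos (k := m - 1) ?_ ?_ <;> push_cast <;> constructor <;> linarith

/-- The transverse coordinate of a linearized solution `(ξ, η)` of a mechanical system in terms of
the velocity `y` and the force `g`. Its imaginary part is the derivative of `area y ξ`. -/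
def pairCoord (y g ξ η : R2) : ℂ := ⟨area g η - area y ξ, area g ξ + area y η⟩

theorem norm_sq_add_mul_area {y g ξ η : R2} (h : inner ℝ y η = inner ℝ g ξ) :
    (‖y‖ ^ 2 + ‖g‖ ^ 2) * area y ξ =
      inner ℝ g y * (pairCoord y g ξ η).im - ‖y‖ ^ 2 * (pairCoord y g ξ η).re := by
  simp only [pairCoord]
  linear_combination norm_sq_mul_area_velocities h

theorem norm_sq_add_mul_im_mul_area {y g ξ η ξ' η' : R2} (h : inner ℝ y η = inner ℝ g ξ)
    (h' : inner ℝ y η' = inner ℝ g ξ') (hJ : area y ξ = 0) :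
    (‖y‖ ^ 2 + ‖g‖ ^ 2) * ((pairCoord y g ξ η).im * area y ξ') =
      ‖y‖ ^ 2 * wedge (pairCoord y g ξ η) (pairCoord y g ξ' η') := by
  have hid := norm_sq_add_mul_area h
  rw [hJ, mul_zero] at hid
  rw [wedge]
  linear_combination (pairCoord y g ξ η).im * norm_sq_add_mul_area h'
    - (pairCoord y g ξ' η').im * hid

/-- A convex pair along a `T`-periodic curve whose transverse coordinate turns counterclockwise,
with continuous argument `θ`. -/
structure RotatingPair (B : ℝ → R2 →L[ℝ] R2) (x y g ξ η : ℝ → R2) (θ : ℝ → ℝ) (T : ℝ) : Prop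
    extends ConvexPair B x y g ξ η where
  arg : IsContinuousArgumentOn (fun t => pairCoord (y t) (g t) (ξ t) (η t)) θ univ
  strictMono : StrictMono θ
  period_pos : 0 < T
  periodic_curve : Function.Periodic x T
  periodic_velocity : Function.Periodic y T
  periodic_force : Function.Periodic g T

namespace RotatingPair

variable {B : ℝ → R2 →L[ℝ] R2} {x y g ξ η : ℝ → R2} {θ : ℝ → ℝ} {T a c₁ c₂ s : ℝ}

theorem exists_polar (h : RotatingPair B x y g ξ η θ T) (t : ℝ) : ∃ r > 0,
    area (g t) (η t) - area (y t) (ξ t) = r * Real.cos (θ t) ∧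
      area (g t) (ξ t) + area (y t) (η t) = r * Real.sin (θ t) := by
  obtain ⟨r, hr, e⟩ := h.arg.2 t (mem_univ t)
  refine ⟨r, hr, ?_, ?_⟩
  · rw [← Complex.exp_ofReal_mul_I_re, ← Complex.re_ofReal_mul, ← e]; rfl
  · rw [← Complex.exp_ofReal_mul_I_im, ← Complex.im_ofReal_mul, ← e]; rfl

theorem deriv_area_ne_zero_iff (h : RotatingPair B x y g ξ η θ T) (t : ℝ) :
    area (g t) (ξ t) + area (y t) (η t) ≠ 0 ↔ Real.sin (θ t) ≠ 0 := by
  obtain ⟨r, hr, -, e⟩ := h.exists_polar t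
  rw [e, mul_ne_zero_iff_left hr.ne']

theorem exists_sin_eq_zero_of_area_eq_zero (h : RotatingPair B x y g ξ η θ T) {a b : ℝ}
    (hab : a < b) (ha : area (y a) (ξ a) = 0) (hb : area (y b) (ξ b) = 0) :
    ∃ c ∈ Ioo a b, Real.sin (θ c) = 0 := by
  obtain ⟨c, hc, hc0⟩ := exists_hasDerivAt_eq_zero hab
    (fun t _ => (h.hasDerivAt_area t).continuousAt.continuousWithinAt) (ha.trans hb.symm)
    fun t _ => h.hasDerivAt_area t
  exact ⟨c, hc, not_not.1 fun hs => (h.deriv_area_ne_zero_iff c).2 hs hc0⟩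

theorem area_velocities_ne_zero (h : RotatingPair B x y g ξ η θ T) {t : ℝ}
    (hJ : area (y t) (ξ t) = 0) (hJ' : area (g t) (ξ t) + area (y t) (η t) = 0) :
    area (g t) (η t) ≠ 0 := fun h0 => h.arg.ne_zero (mem_univ t) <| by
  rw [pairCoord, h0, hJ, hJ', sub_zero]
  rfl

theorem deriv_area_ne_zero (h : RotatingPair B x y g ξ η θ T) {t : ℝ} (hy : y t ≠ 0)
    (hJ : area (y t) (ξ t) = 0) : area (g t) (ξ t) + area (y t) (η t) ≠ 0 := fun hJ' => by
  have hid := norm_sq_mul_area_velocities (h.symplectic t)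
  rw [hJ, hJ', mul_zero, mul_zero, sub_zero] at hid
  exact h.area_velocities_ne_zero hJ hJ' ((mul_eq_zero.1 hid).resolve_left
    (pow_pos (norm_pos_iff.2 hy) 2).ne')

theorem wedge_pairCoord_nonpos (h : RotatingPair B x y g ξ η θ T)
    (hpi : θ a + Real.pi < θ (a + T)) (hle : θ (a + T) ≤ θ a + 2 * Real.pi) :
    wedge (pairCoord (y a) (g a) (ξ a) (η a))
      (pairCoord (y (a + T)) (g (a + T)) (ξ (a + T)) (η (a + T))) ≤ 0 := by
  obtain ⟨r, hr, e⟩ := h.arg.2 a (mem_univ a)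
  obtain ⟨r', hr', e'⟩ := h.arg.2 (a + T) (mem_univ _)
  rw [wedge_polar e e']
  refine mul_nonpos_of_nonneg_of_nonpos (mul_pos hr hr').le ?_
  rw [← Real.sin_sub_two_pi]
  exact Real.sin_nonpos_of_nonpos_of_neg_pi_le (by linarith) (by linarith)

theorem norm_sq_add_norm_sq_pos (h : RotatingPair B x y g ξ η θ T) (t : ℝ) :
    0 < ‖y t‖ ^ 2 + ‖g t‖ ^ 2 := by
  by_cases hy : y t = 0
  · exact add_pos_of_nonneg_of_pos (sq_nonneg _) (pow_pos (norm_pos_iff.2 (h.force_ne_zero t hy)) 2)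
  · exact add_pos_of_pos_of_nonneg (pow_pos (norm_pos_iff.2 hy) 2) (sq_nonneg _)

theorem not_two_critical_before_zero (h : RotatingPair B x y g ξ η θ T)
    (hle : θ (a + T) ≤ θ a + 2 * Real.pi) (ha : area (y a) (ξ a) = 0) (hac : a < c₁) (hc : c₁ < c₂)
    (hcs : c₂ ≤ s) (hsT : s < a + T) (h₁ : Real.sin (θ c₁) = 0) (h₂ : Real.sin (θ c₂) = 0)
    (hs : area (y s) (ξ s) = 0) : False := by
  have hcross {t : ℝ} (hst : s < t) (htT : t ≤ a + T) :=
    pi_lt_and_sin_mul_sin_pos h.strictMono hac hc (hcs.trans_lt hst) h₁ h₂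
      ((h.strictMono.monotone htT).trans hle)
  obtain ⟨t, ht, hslope⟩ := exists_hasDerivAt_eq_slope (fun s => area (y s) (ξ s)) _ hsT
    (fun t _ => (h.hasDerivAt_area t).continuousAt.continuousWithinAt)
    fun t _ => h.hasDerivAt_area t
  have hlast : 0 < Real.sin (θ a) * area (y (a + T)) (ξ (a + T)) := by
    obtain ⟨r, hr, -, e⟩ := h.exists_polar t
    rw [hs, sub_zero, eq_div_iff (sub_pos.2 hsT).ne', e] at hslope
    calc 0 < r * (a + T - s) * (Real.sin (θ a) * Real.sin (θ t)) :=
          mul_pos (mul_pos hr (sub_pos.2 hsT)) (hcross ht.1 ht.2.le).2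
      _ = Real.sin (θ a) * area (y (a + T)) (ξ (a + T)) := by rw [← hslope]; ring
  have hid := norm_sq_add_mul_im_mul_area (η' := η (a + T)) (h.symplectic a)
    (by simpa only [h.periodic_velocity a, h.periodic_force a] using h.symplectic (a + T)) ha
  have hwedge := h.wedge_pairCoord_nonpos (hcross hsT le_rfl).1 hle
  obtain ⟨r, hr, -, him⟩ := h.exists_polar a
  have him : (pairCoord (y a) (g a) (ξ a) (η a)).im = r * Real.sin (θ a) := him
  rw [h.periodic_velocity a] at hlast hwedge
  rw [h.periodic_force a] at hwedge
  rw [him, mul_assoc] at hid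
  have hneg := mul_nonpos_of_nonneg_of_nonpos (sq_nonneg ‖y a‖) hwedge
  rw [← hid] at hneg
  exact hneg.not_gt (mul_pos (h.norm_sq_add_norm_sq_pos a) (mul_pos hr hlast))

theorem area_zeros_subsingleton (h : RotatingPair B x y g ξ η θ T)
    (hle : θ (a + T) ≤ θ a + 2 * Real.pi) (ha : area (y a) (ξ a) = 0) :
    {t ∈ Ioo a (a + T) | area (y t) (ξ t) = 0}.Subsingleton := by
  suffices hlt : ∀ s₁ ∈ Ioo a (a + T), ∀ s₂ ∈ Ioo a (a + T), area (y s₁) (ξ s₁) = 0 →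
      area (y s₂) (ξ s₂) = 0 → ¬ s₁ < s₂ from fun s₁ hs₁ s₂ hs₂ =>
    le_antisymm (not_lt.1 (hlt _ hs₂.1 _ hs₁.1 hs₂.2 hs₁.2))
      (not_lt.1 (hlt _ hs₁.1 _ hs₂.1 hs₁.2 hs₂.2))
  intro s₁ hs₁ s₂ hs₂ h₁ h₂ hlt
  obtain ⟨c₁, hc₁, hsin₁⟩ := h.exists_sin_eq_zero_of_area_eq_zero hs₁.1 ha h₁
  obtain ⟨c₂, hc₂, hsin₂⟩ := h.exists_sin_eq_zero_of_area_eq_zero hlt h₁ h₂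
  exact h.not_two_critical_before_zero hle ha hc₁.1 (hc₁.2.trans hc₂.1) hc₂.2.le hs₂.2 hsin₁ hsin₂
    h₂

theorem area_zeros_simple (h : RotatingPair B x y g ξ η θ T)
    (hle : θ (a + T) ≤ θ a + 2 * Real.pi) (ha : area (y a) (ξ a) = 0) (hs : s ∈ Ioo a (a + T))
    (hJ : area (y s) (ξ s) = 0) : area (g s) (ξ s) + area (y s) (η s) ≠ 0 := by
  refine (h.deriv_area_ne_zero_iff s).2 fun hsin => ?_
  obtain ⟨c, hc, hsinc⟩ := h.exists_sin_eq_zero_of_area_eq_zero hs.1 ha hJ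
  exact h.not_two_critical_before_zero hle ha hc.1 hc.2 le_rfl hs.2 hsinc hsin hJ

/-- The Riccati form of a test field tangent to the curve at `a` would return to its initial value
after one period. -/
theorem false_of_velocity_ne_zero (h : RotatingPair B x y g ξ η θ T) (hy : y a ≠ 0)
    (huniq : {t ∈ Ioo a (a + T) | area (y t) (ξ t) = 0}.Subsingleton)
    (hsimple : ∀ t ∈ Ioo a (a + T), area (y t) (ξ t) = 0 →
      area (g t) (ξ t) + area (y t) (η t) ≠ 0) : False := by
  obtain ⟨v, κ, hp, hlt⟩ := h.exists_testField_riccati_limit_lt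
    (lt_add_of_pos_right a h.period_pos) huniq hsimple !₂[-y a 1, y a 0]
  have htan : area (y a) (v + κ • x a) = 0 := by
    simp only [inner_R2, Matrix.cons_val] at hp
    rw [area]
    linarith
  have hX (t : ℝ) := h.hasDerivAt_testField v κ t
  have hyT : y (a + T) ≠ 0 := by rwa [h.periodic_velocity]
  have hend := h.tendsto_riccati_of_tangent (hX (a + T)) hyT
    (by rwa [h.periodic_velocity, h.periodic_curve]) (h.deriv_area_ne_zero hyT)
  rw [h.periodic_velocity, h.periodic_force, h.periodic_curve] at hend
  exact lt_irrefl _ (hlt _ _ (h.tendsto_riccati_of_tangent (hX a) hy htan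
    (h.deriv_area_ne_zero hy)) hend)

/-- A test field vanishing at a brake point has Riccati limit `0` there, before and after one
period. -/
theorem exists_area_eq_zero_of_brake (h : RotatingPair B x y g ξ η θ T) (hy : y a = 0) :
    ∃ s ∈ Ioo a (a + T), area (y s) (ξ s) = 0 := by
  by_contra! hJ
  have hlim (t : ℝ) (hyt : y t = 0) (hxt : x t = x a) :
      Tendsto (fun s => riccati 1 (y s) (g s) (ξ s) (η s) (-x a + (1 : ℝ) • x s)) (𝓝[≠] t) (𝓝 0) :=
    h.tendsto_riccati_of_brake_of_field_eq_zero (h.hasDerivAt_testField _ 1 t) hyt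
      (by rw [hxt, one_smul, neg_add_cancel]) (h.force_ne_zero t hyt) fun h0 =>
        h.area_velocities_ne_zero (by rw [hyt, area_zero_left])
          (by rw [hyt, h0, area_zero_left, add_zero])
  exact lt_irrefl _ (h.riccati_limit_lt (Or.inl one_ne_zero) (lt_add_of_pos_right a h.period_pos)
    hJ (hlim a hy rfl) (hlim (a + T) (by rwa [h.periodic_velocity]) (h.periodic_curve a)))

theorem area_ne_zero_of_brake (h : RotatingPair B x y g ξ η θ T) {t : ℝ} (hy : y t = 0)
    (hsin : Real.sin (θ t) ≠ 0) : area (g t) (ξ t) ≠ 0 := by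
  have := (h.deriv_area_ne_zero_iff t).2 hsin
  rwa [hy, area_zero_left, add_zero] at this

theorem cot_le_of_brake (h : RotatingPair B x y g ξ η θ T) (hpi : θ a + Real.pi < θ (a + T))
    (hle : θ (a + T) ≤ θ a + 2 * Real.pi) (hsin : 0 < Real.sin (θ a) * Real.sin (θ (a + T)))
    (hy : y a = 0) :
    area (g a) (η a) / area (g a) (ξ a) ≤
      area (g (a + T)) (η (a + T)) / area (g (a + T)) (ξ (a + T)) := by
  have hyT : y (a + T) = 0 := by rwa [h.periodic_velocity]
  have hwedge := h.wedge_pairCoord_nonpos hpi hle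
  obtain ⟨r, hr, -, e⟩ := h.exists_polar a
  obtain ⟨r', hr', -, e'⟩ := h.exists_polar (a + T)
  simp only [wedge, pairCoord, hy, hyT, area_zero_left, sub_zero, add_zero] at hwedge e e'
  have hprod : 0 < area (g a) (ξ a) * area (g (a + T)) (ξ (a + T)) := by
    rw [e, e', mul_mul_mul_comm]
    exact mul_pos (mul_pos hr hr') hsin
  rw [← sub_nonpos, div_sub_div _ _ (h.area_ne_zero_of_brake hy (left_ne_zero_of_mul hsin.ne'))
    (h.area_ne_zero_of_brake hyT (right_ne_zero_of_mul hsin.ne'))]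
  exact div_nonpos_of_nonpos_of_nonneg hwedge hprod.le

/-- Between two consecutive passages through a brake point `θ` increases by more than `π`, so the
Riccati form, which tends to `‖X‖² cot θ` there, could not decrease. -/
theorem false_of_brake (h : RotatingPair B x y g ξ η θ T)
    (hle : θ (a + T) ≤ θ a + 2 * Real.pi) (hy : y a = 0) : False := by
  have ha : area (y a) (ξ a) = 0 := by rw [hy, area_zero_left]
  have hyT : y (a + T) = 0 := by rwa [h.periodic_velocity]
  have haT : area (y (a + T)) (ξ (a + T)) = 0 := by rw [hyT, area_zero_left]
  obtain ⟨s, hs, hJ⟩ := h.exists_area_eq_zero_of_brake hy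
  obtain ⟨c₁, hc₁, hsin₁⟩ := h.exists_sin_eq_zero_of_area_eq_zero hs.1 ha hJ
  obtain ⟨c₂, hc₂, hsin₂⟩ := h.exists_sin_eq_zero_of_area_eq_zero hs.2 hJ haT
  obtain ⟨hpi, hsin⟩ := pi_lt_and_sin_mul_sin_pos h.strictMono hc₁.1 (hc₁.2.trans hc₂.1) hc₂.2
    hsin₁ hsin₂ hle
  obtain ⟨v, κ, hg, hlt⟩ := h.exists_testField_riccati_limit_lt
    (lt_add_of_pos_right a h.period_pos) (h.area_zeros_subsingleton hle ha)
    (fun t => h.area_zeros_simple hle ha) (g a)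
  have hX (t : ℝ) := h.hasDerivAt_testField v κ t
  have hend := h.tendsto_riccati_of_brake (hX (a + T)) hyT
    (by rwa [h.periodic_force, h.periodic_curve])
    (h.area_ne_zero_of_brake hyT (right_ne_zero_of_mul hsin.ne'))
  rw [h.periodic_curve] at hend
  exact (hlt _ _ (h.tendsto_riccati_of_brake (hX a) hy hg
    (h.area_ne_zero_of_brake hy (left_ne_zero_of_mul hsin.ne'))) hend).not_ge
      (mul_le_mul_of_nonneg_left (h.cot_le_of_brake hpi hle hsin hy) (sq_nonneg _))

theorem exists_two_pi_lt (h : RotatingPair B x y g ξ η θ T) :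
    ∃ a, θ a + 2 * Real.pi < θ (a + T) := by
  by_contra! hle
  by_cases hzero : ∃ a, area (y a) (ξ a) = 0
  · obtain ⟨a, ha⟩ := hzero
    by_cases hy : y a = 0
    · exact h.false_of_brake (hle a) hy
    · exact h.false_of_velocity_ne_zero hy (h.area_zeros_subsingleton (hle a) ha)
        fun t => h.area_zeros_simple (hle a) ha
  · push Not at hzero
    exact h.false_of_velocity_ne_zero (a := 0)
      (fun hy => hzero 0 (by rw [hy, area_zero_left]))
      (fun t ht => absurd ht.2 (hzero t)) fun t _ ht => absurd ht (hzero t)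

end RotatingPair

section Turn

variable {F : R4 → ℝ} {w u : ℝ → R4} {θ : ℝ → ℝ} {T : ℝ}

theorem IsLinearizedSolutionOn.comp_add_const (hu : IsLinearizedSolutionOn F w u univ)
    (hT : Function.Periodic w T) : IsLinearizedSolutionOn F w (fun t => u (t + T)) univ := by
  intro t _
  obtain ⟨htan, hderiv⟩ := hu (t + T) (mem_univ _)
  rw [hT] at htan hderiv
  exact ⟨htan, hderiv.comp_add_const t T⟩

/-- The skew product of `u` and its translate by one period is constant, so the turn over one
period can reach a multiple of `π` only if it is constant. -/
theorem two_pi_lt_turn_of_exists (hF : ContDiff ℝ 2 F) (hT : Function.Periodic w T)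
    (h0 : ∀ t, gradient F (w t) ≠ 0) (hu : IsLinearizedSolutionOn F w u univ)
    (hθ : IsContinuousArgumentOn (transverse F w u) θ univ)
    (h : ∃ a, θ a + 2 * Real.pi < θ (a + T)) (t : ℝ) : θ t + 2 * Real.pi < θ (t + T) := by
  obtain ⟨a, ha⟩ := h
  have hu' := hu.comp_add_const hT
  rw [isContinuousArgumentOn_transverse_iff fun t _ => h0 t] at hθ
  have hθ' : IsContinuousArgumentOn (fun t => transverseCoord (gradient F (w t)) (u (t + T)))
      (fun t => θ (t + T)) univ :=
    ⟨(hθ.continuous.comp (continuous_add_const T)).continuousOn, fun t _ => by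
      simpa only [hT t] using hθ.2 (t + T) (mem_univ _)⟩
  have hwedge (s : ℝ) : wedge (transverseCoord (gradient F (w s)) (u s))
      (transverseCoord (gradient F (w s)) (u (s + T))) = 0 ↔ omega0 (u 0) (u (0 + T)) = 0 := by
    rw [wedge_transverseCoord (hu s (mem_univ s)).1 (hu' s (mem_univ s)).1,
      hu.omega0_eq hF hu' s 0, mul_eq_zero,
      or_iff_right (pow_pos (norm_pos_iff.2 (h0 s)) 2).ne']
  by_contra! hle
  obtain ⟨s, hs⟩ : 2 * Real.pi ∈ range fun t => θ (t + T) - θ t :=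
    mem_range_of_exists_le_of_exists_ge (hθ'.continuous.sub hθ.continuous)
      ⟨t, by linarith⟩ ⟨a, by linarith⟩
  have hs0 := (hwedge s).1 <| (hθ.sin_sub_eq_zero_iff hθ' (mem_univ s)).1 <|
    (congrArg Real.sin hs).trans Real.sin_two_pi
  have := hθ.turn_eq_turn hθ' (fun t => (hwedge t).2 hs0) s a
  linarith

end Turn

/-! ### Mechanical Hamiltonians with two degrees of freedom -/

/-- The projection `(x, y) ↦ y`. -/
def mom (w : R4) : R2 := !₂[w 2, w 3]

/-- The point of phase space with position `x` and momentum `y`. -/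
def phase (x y : R2) : R4 := !₂[x 0, x 1, y 0, y 1]

/-- The mechanical Hamiltonian `|y|²/2 + U(x)` with potential `U`. -/
def mechanical (U : R2 → ℝ) (w : R4) : ℝ := ‖mom w‖ ^ 2 / 2 + U (proj w)

theorem inner_phase (x y : R2) (u : R4) :
    inner ℝ (phase x y) u = inner ℝ x (proj u) + inner ℝ y (mom u) := by
  simp only [inner_R4, inner_R2, phase, proj, mom, Matrix.cons_val]
  ring

theorem proj_phase (x y : R2) : proj (phase x y) = x := by
  ext i; fin_cases i <;> rfl

theorem mom_phase (x y : R2) : mom (phase x y) = y := by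
  ext i; fin_cases i <;> rfl

theorem phase_eq_zero_iff {x y : R2} : phase x y = 0 ↔ x = 0 ∧ y = 0 := by
  simp [PiLp.ext_iff, Fin.forall_fin_succ, phase, and_assoc]

theorem j3_phase (x y : R2) : j3 (phase x y) = phase y (-x) := by
  ext i; fin_cases i <;> rfl

theorem transverseCoord_phase (g y : R2) (u : R4) :
    transverseCoord (phase (-g) y) u = pairCoord y g (proj u) (mom u) := by
  apply Complex.ext <;> simp only [transverseCoord, pairCoord, area, inner_R4, j1, j2, phase, proj,
    mom, PiLp.neg_apply, Matrix.cons_val] <;> ring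

theorem hasDerivAt_line {E : Type*} [NormedAddCommGroup E] [NormedSpace ℝ E] (x v : E) :
    HasDerivAt (fun s : ℝ => x + s • v) v 0 := by
  simpa using ((hasDerivAt_id (0 : ℝ)).smul_const v).const_add x

section Deriv

variable {w : ℝ → R4} {w' : R4} {x y : ℝ → R2} {x' y' : R2} {t : ℝ}

theorem hasDerivAt_proj (hw : HasDerivAt w w' t) : HasDerivAt (fun s => proj (w s)) (proj w') t :=
  hasDerivAt_euclidean.2 <| Fin.forall_fin_two.2
    ⟨hasDerivAt_euclidean.1 hw 0, hasDerivAt_euclidean.1 hw 1⟩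

theorem hasDerivAt_mom (hw : HasDerivAt w w' t) : HasDerivAt (fun s => mom (w s)) (mom w') t :=
  hasDerivAt_euclidean.2 <| Fin.forall_fin_two.2
    ⟨hasDerivAt_euclidean.1 hw 2, hasDerivAt_euclidean.1 hw 3⟩

theorem hasDerivAt_phase (hx : HasDerivAt x x' t) (hy : HasDerivAt y y' t) :
    HasDerivAt (fun s => phase (x s) (y s)) (phase x' y') t := by
  rw [hasDerivAt_euclidean] at hx hy ⊢
  intro i
  fin_cases i
  exacts [hx 0, hx 1, hy 0, hy 1]

end Deriv

section Mechanical

variable {U : R2 → ℝ}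

theorem contDiff_mechanical {n : WithTop ℕ∞} (hU : ContDiff ℝ n U) :
    ContDiff ℝ n (mechanical U) := by
  have hmom : ContDiff ℝ n mom := contDiff_euclidean.2 <| Fin.forall_fin_two.2
    ⟨by simp only [mom, Matrix.cons_val]; fun_prop, by simp only [mom, Matrix.cons_val]; fun_prop⟩
  have hproj : ContDiff ℝ n proj := contDiff_euclidean.2 <| Fin.forall_fin_two.2
    ⟨by simp only [proj, Matrix.cons_val]; fun_prop, by simp only [proj, Matrix.cons_val]; fun_prop⟩
  exact ((hmom.norm_sq ℝ).div_const 2).add (hU.comp hproj)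

theorem hasDerivAt_mechanical (hU : Differentiable ℝ U) {w : ℝ → R4} {w' : R4} {t : ℝ}
    (hw : HasDerivAt w w' t) : HasDerivAt (fun s => mechanical U (w s))
      (inner ℝ (phase (gradient U (proj (w t))) (mom (w t))) w') t := by
  refine (((hasDerivAt_mom hw).norm_sq.div_const 2).add
    ((hU _).hasFDerivAt.comp_hasDerivAt t (hasDerivAt_proj hw))).congr_deriv ?_
  rw [inner_phase, inner_gradient_left]
  ring

theorem hasDerivAt_gradient_proj (hU : Differentiable ℝ (gradient U)) {w : ℝ → R4} {w' : R4}
    {t : ℝ} (hw : HasDerivAt w w' t) : HasDerivAt (fun s => gradient U (proj (w s)))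
      (fderiv ℝ (gradient U) (proj (w t)) (proj w')) t :=
  (hU _).hasFDerivAt.comp_hasDerivAt t (hasDerivAt_proj hw)

theorem gradient_mechanical (hU : ContDiff ℝ 2 U) (w : R4) :
    gradient (mechanical U) w = phase (gradient U (proj w)) (mom w) := by
  refine ext_inner_right ℝ fun v => ?_
  rw [inner_gradient_left,
    ← ((contDiff_mechanical hU).differentiable two_ne_zero w).lineDeriv_eq_fderiv]
  simpa using HasLineDerivAt.lineDeriv
    (hasDerivAt_mechanical (hU.differentiable two_ne_zero) (hasDerivAt_line w v))

theorem hessian_mechanical (hU : ContDiff ℝ 2 U) (w v : R4) :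
    hessian (mechanical U) w v = phase (fderiv ℝ (gradient U) (proj w) (proj v)) (mom v) := by
  rw [hessian, ← (differentiable_gradient (contDiff_mechanical hU) w).lineDeriv_eq_fderiv]
  refine HasLineDerivAt.lineDeriv ?_
  simp only [HasLineDerivAt, gradient_mechanical hU]
  refine hasDerivAt_phase ?_ (hasDerivAt_mom (hasDerivAt_line w v))
  simpa using hasDerivAt_gradient_proj (differentiable_gradient hU) (hasDerivAt_line w v)

end Mechanical

/-- The level set of `|y|²/2 + U(x)` through `w` is regular and convex at `w`, strictly convex
if the momentum is not zero. For `y ≠ 0` the vector `(v, η)` is tangent if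
`⟪y, η⟫ = -⟪∇U, v⟫`, and `convex` is `⟪D²U v, v⟫ + |η|² > 0` minimized over such `η`. -/
structure ConvexAt (U : R2 → ℝ) (w : R4) : Prop where
  gradient_ne_zero : mom w = 0 → gradient U (proj w) ≠ 0
  convex_brake : mom w = 0 → ∀ v, inner ℝ (gradient U (proj w)) v = 0 →
    0 ≤ inner ℝ (fderiv ℝ (gradient U) (proj w) v) v
  convex : mom w ≠ 0 → ∀ v ≠ 0, 0 < ‖mom w‖ ^ 2 * inner ℝ (fderiv ℝ (gradient U) (proj w) v) v
    + inner ℝ (gradient U (proj w)) v ^ 2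

namespace ConvexAt

variable {U : R2 → ℝ} {w v : R4}

theorem gradient_mechanical_ne_zero (h : ConvexAt U w) (hU : ContDiff ℝ 2 U) :
    gradient (mechanical U) w ≠ 0 := by
  rw [gradient_mechanical hU, Ne, phase_eq_zero_iff]
  exact fun ⟨hgrad, hmom⟩ => h.gradient_ne_zero hmom hgrad

theorem inner_hessian_nonneg (h : ConvexAt U w) (hU : ContDiff ℝ 2 U)
    (hv : inner ℝ (gradient (mechanical U) w) v = 0) :
    0 ≤ inner ℝ (hessian (mechanical U) w v) v := by
  rw [gradient_mechanical hU, inner_phase] at hv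
  rw [hessian_mechanical hU, inner_phase, real_inner_self_eq_norm_sq]
  by_cases hy : mom w = 0
  · rw [hy, inner_zero_left, add_zero] at hv
    exact add_nonneg (h.convex_brake hy _ hv) (sq_nonneg _)
  by_cases hx : proj v = 0
  · simp [hx]
  have hconvex := h.convex hy (proj v) hx
  have hcs : inner ℝ (gradient U (proj w)) (proj v) ^ 2 ≤ ‖mom w‖ ^ 2 * ‖mom v‖ ^ 2 := by
    rw [eq_neg_of_add_eq_zero_left hv, neg_sq, ← mul_pow]
    exact sq_le_sq.2 ((abs_real_inner_le_norm _ _).trans (le_abs_self _))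
  refine (pos_of_mul_pos_right (?_ : 0 < ‖mom w‖ ^ 2 * _) (sq_nonneg _)).le
  linarith

theorem inner_hessian_flow_pos (h : ConvexAt U w) (hU : ContDiff ℝ 2 U) :
    0 < inner ℝ (hessian (mechanical U) w (j3 (gradient (mechanical U) w)))
      (j3 (gradient (mechanical U) w)) := by
  rw [gradient_mechanical hU, j3_phase, hessian_mechanical hU, inner_phase, proj_phase, mom_phase,
    real_inner_self_eq_norm_sq, norm_neg]
  by_cases hy : mom w = 0
  · rw [hy, map_zero, inner_zero_left, zero_add]
    exact pow_pos (norm_pos_iff.2 (h.gradient_ne_zero hy)) 2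
  have hconvex := h.convex hy (mom w) hy
  have hcs : inner ℝ (gradient U (proj w)) (mom w) ^ 2
      ≤ ‖mom w‖ ^ 2 * ‖gradient U (proj w)‖ ^ 2 := by
    rw [← mul_pow, mul_comm]
    exact sq_le_sq.2 ((abs_real_inner_le_norm _ _).trans (le_abs_self _))
  refine pos_of_mul_pos_right (?_ : 0 < ‖mom w‖ ^ 2 * _) (sq_nonneg _)
  linarith

end ConvexAt

section ConvexEnergySurface

variable {U : R2 → ℝ} {w u : ℝ → R4} {θ : ℝ → ℝ} {I : Set ℝ} {t T : ℝ}

theorem exists_hasDerivAt_argument_pos_of_convexAt (hU : ContDiff ℝ 2 U)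
    (hw : IsTrajectoryOn (mechanical U) w I) (hconv : ∀ s ∈ I, ConvexAt U (w s)) (hI : I ∈ 𝓝 t)
    (hu : IsLinearizedSolutionOn (mechanical U) w u I)
    (hθ : IsContinuousArgumentOn (transverse (mechanical U) w u) θ I) :
    ∃ θ' > 0, HasDerivAt θ θ' t :=
  have ht := hconv t (mem_of_mem_nhds hI)
  exists_hasDerivAt_argument_pos (differentiable_gradient (contDiff_mechanical hU)) hw
    (fun s hs => (hconv s hs).gradient_mechanical_ne_zero hU) hI
    (fun _ => ht.inner_hessian_nonneg hU) (ht.inner_hessian_flow_pos hU) hu hθ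

theorem isJacobiField_trajectory (hU : ContDiff ℝ 2 U) (hw : IsTrajectoryOn (mechanical U) w univ) :
    IsJacobiField (fun t => fderiv ℝ (gradient U) (proj (w t))) (fun t => mom (w t))
      (fun t => -gradient U (proj (w t))) where
  deriv_position t := by
    have := hasDerivAt_mom (hw t (mem_univ t))
    rwa [gradient_mechanical hU, j3_phase, mom_phase] at this
  deriv_velocity t := by
    have := hasDerivAt_gradient_proj (differentiable_gradient hU) (hw t (mem_univ t))
    rw [gradient_mechanical hU, j3_phase, proj_phase] at this
    exact this.neg

theorem isJacobiField_linearizedSolution (hU : ContDiff ℝ 2 U)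
    (hu : IsLinearizedSolutionOn (mechanical U) w u univ) :
    IsJacobiField (fun t => fderiv ℝ (gradient U) (proj (w t))) (fun t => proj (u t))
      (fun t => mom (u t)) where
  deriv_position t := by
    have := hasDerivAt_proj (hu t (mem_univ t)).2
    rwa [hessian_mechanical hU, j3_phase, proj_phase] at this
  deriv_velocity t := by
    have := hasDerivAt_mom (hu t (mem_univ t)).2
    rwa [hessian_mechanical hU, j3_phase, mom_phase] at this

theorem lagrangianPair_linearizedSolution (hU : ContDiff ℝ 2 U)
    (hw : IsTrajectoryOn (mechanical U) w univ)
    (hu : IsLinearizedSolutionOn (mechanical U) w u univ) :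
    LagrangianPair (fun t => fderiv ℝ (gradient U) (proj (w t))) (fun t => mom (w t))
      (fun t => -gradient U (proj (w t))) (fun t => proj (u t)) (fun t => mom (u t)) where
  left := isJacobiField_trajectory hU hw
  right := isJacobiField_linearizedSolution hU hu
  symplectic t := by
    have := (hu t (mem_univ t)).1
    rw [gradient_mechanical hU, inner_phase] at this
    rw [inner_neg_left]
    linarith

theorem convexPair_linearizedSolution (hU : ContDiff ℝ 2 U)
    (hw : IsTrajectoryOn (mechanical U) w univ) (hconv : ∀ t, ConvexAt U (w t))
    (hu : IsLinearizedSolutionOn (mechanical U) w u univ) :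
    ConvexPair (fun t => fderiv ℝ (gradient U) (proj (w t))) (fun t => proj (w t))
      (fun t => mom (w t)) (fun t => -gradient U (proj (w t))) (fun t => proj (u t))
      (fun t => mom (u t)) where
  toLagrangianPair := lagrangianPair_linearizedSolution hU hw hu
  deriv_curve t := by
    have := hasDerivAt_proj (hw t (mem_univ t))
    rwa [gradient_mechanical hU, j3_phase, proj_phase] at this
  force_ne_zero t hy := neg_ne_zero.2 ((hconv t).gradient_ne_zero hy)
  convex t hy v hv := by
    rw [inner_neg_left, neg_sq]
    exact (hconv t).convex hy v hv

theorem rotatingPair_linearizedSolution (hU : ContDiff ℝ 2 U)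
    (hP : IsPeriodicOrbit (mechanical U) w T) (hconv : ∀ t, ConvexAt U (w t))
    (hu : IsLinearizedSolutionOn (mechanical U) w u univ)
    (hθ : IsContinuousArgumentOn (transverse (mechanical U) w u) θ univ) :
    RotatingPair (fun t => fderiv ℝ (gradient U) (proj (w t))) (fun t => proj (w t))
      (fun t => mom (w t)) (fun t => -gradient U (proj (w t))) (fun t => proj (u t))
      (fun t => mom (u t)) θ T where
  toConvexPair := convexPair_linearizedSolution hU hP.2.1 hconv hu
  arg := by
    rw [isContinuousArgumentOn_transverse_iff fun t _ =>
      (hconv t).gradient_mechanical_ne_zero hU] at hθ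
    refine hθ.congr_curve fun t _ => ?_
    rw [gradient_mechanical hU, ← transverseCoord_phase, neg_neg]
  strictMono := strictMono_of_deriv_pos fun t => by
    obtain ⟨θ', hpos, hderiv⟩ := exists_hasDerivAt_argument_pos_of_convexAt hU hP.2.1
      (fun t _ => hconv t) (univ_mem (f := 𝓝 t)) hu hθ
    rwa [hderiv.deriv]
  period_pos := hP.1
  periodic_curve := hP.2.2.1.comp proj
  periodic_velocity := hP.2.2.1.comp mom
  periodic_force := hP.2.2.1.comp fun z => -gradient U (proj z)

theorem one_lt_of_mem_rotationSet (hU : ContDiff ℝ 2 U)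
    (hP : IsPeriodicOrbit (mechanical U) w T) (hconv : ∀ t, ConvexAt U (w t)) {r : ℝ}
    (hr : r ∈ rotationSet (mechanical U) w T) : 1 < r := by
  obtain ⟨u, θ, hu, hθ, rfl⟩ := hr
  have hturn := two_pi_lt_turn_of_exists (contDiff_mechanical hU) hP.2.2.1
    (fun t => (hconv t).gradient_mechanical_ne_zero hU) hu hθ
    (rotatingPair_linearizedSolution hU hP hconv hu hθ).exists_two_pi_lt 0
  rw [zero_add] at hturn
  rw [one_lt_div Real.two_pi_pos]
  linarith

theorem dynamicallyConvex_of_convexAt (hU : ContDiff ℝ 2 U) {S : Set R4}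
    (hS : ∀ w ∈ S, ConvexAt U w) : DynamicallyConvex (mechanical U) S := by
  intro w T hP hwS
  have hconv (t : ℝ) := hS _ (hwS t)
  obtain ⟨a, b, hab, hlen, hI⟩ := exists_rotationSet_eq_Icc (contDiff_mechanical hU) hP.2.1
    (fun t => (hconv t).gradient_mechanical_ne_zero hU) T
  have ha : 1 < a := one_lt_of_mem_rotationSet hU hP hconv (hI ▸ left_mem_Icc.2 hab)
  exact ⟨existsUnique_hasIndex hab (by linarith) hI, fun μ hμ =>
    two_mul_add_one_le_of_hasIndex (m := 1) hab hI (by exact_mod_cast ha) hμ⟩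

theorem quaternionFramePositive_of_convexAt (hU : ContDiff ℝ 2 U) {S : Set R4}
    (hS : ∀ w ∈ S, ConvexAt U w) : QuaternionFramePositive (mechanical U) S := by
  refine ⟨fun w hw => ?_, fun a b w u θ hwS hw hu hθ t ht => ?_⟩
  · have h0 := (hS w hw).gradient_mechanical_ne_zero hU
    exact ⟨h0, omega0_frame h0⟩
  · obtain ⟨θ', hpos, hderiv⟩ := exists_hasDerivAt_argument_pos_of_convexAt hU hw
      (fun s hs => hS _ (hwS s hs)) (isOpen_Ioo.mem_nhds ht) hu hθ
    rwa [hderiv.deriv]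

end ConvexEnergySurface

/-! ### The Hénon–Heiles potential as a product of three affine functions -/

/-- The affine function `1 + 2 ⟪v, x⟫`. For a vertex `v` of the triangle `K` it vanishes on the
side opposite to `v`. -/
def edge (v x : R2) : ℝ := 1 + 2 * inner ℝ v x

theorem contDiff_V {n : WithTop ℕ∞} : ContDiff ℝ n V := by
  unfold V
  fun_prop

theorem H_eq_mechanical : H = mechanical V := by
  funext w
  rw [H, mechanical, norm_sq_R2]
  rfl

theorem v1_add_v2_add_v3 : v1 + v2 + v3 = 0 := by
  ext i; fin_cases i <;> simp only [v1, v2, v3, PiLp.add_apply, PiLp.zero_apply, Fin.zero_eta,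
    Fin.mk_one, Matrix.cons_val] <;> ring

theorem inner_v1_v1 : inner ℝ v1 v1 = 1 := by
  simp only [inner_R2, v1, Matrix.cons_val]
  norm_num

theorem inner_v2_v2 : inner ℝ v2 v2 = 1 := by
  simp only [inner_R2, v2, Matrix.cons_val]
  linear_combination (1 / 4) * Real.sq_sqrt (show (0 : ℝ) ≤ 3 by norm_num)

theorem inner_v3_v3 : inner ℝ v3 v3 = 1 := by
  simp only [inner_R2, v3, Matrix.cons_val]
  linear_combination (1 / 4) * Real.sq_sqrt (show (0 : ℝ) ≤ 3 by norm_num)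

theorem inner_v1_v2 : inner ℝ v1 v2 = -1 / 2 := by
  simp [inner_R2, v1, v2]

theorem inner_v1_v3 : inner ℝ v1 v3 = -1 / 2 := by
  simp [inner_R2, v1, v3]

theorem inner_v2_v3 : inner ℝ v2 v3 = -1 / 2 := by
  simp only [inner_R2, v2, v3, Matrix.cons_val]
  linear_combination (-1 / 4) * Real.sq_sqrt (show (0 : ℝ) ≤ 3 by norm_num)

theorem edge_nonneg_of_mem_K {v x : R2} (hv : v ∈ ({v1, v2, v3} : Set R2)) (hx : x ∈ K) :
    0 ≤ edge v x := by
  have hvert : ({v1, v2, v3} : Set R2) ⊆ {x | -1 / 2 ≤ inner ℝ v x} := by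
    have h₁ := inner_v1_v2
    have h₂ := inner_v1_v3
    have h₃ := inner_v2_v3
    rw [real_inner_comm] at h₁ h₂ h₃
    rcases hv with rfl | rfl | rfl <;> rintro x (rfl | rfl | rfl) <;>
      simp only [mem_ofPred_eq, inner_v1_v1, inner_v2_v2, inner_v3_v3, inner_v1_v2, inner_v1_v3,
        inner_v2_v3, h₁, h₂, h₃] <;> norm_num
  have hinner : -1 / 2 ≤ inner ℝ v x :=
    convexHull_min hvert (convex_halfSpace_ge (innerₛₗ ℝ v).isLinear _) hx
  rw [edge]
  linarith

theorem eq_smul_sum_inner_smul (x : R2) : x =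
    (2 / 3 : ℝ) • (inner ℝ v1 x • v1 + inner ℝ v2 x • v2 + inner ℝ v3 x • v3) := by
  have h3 := Real.sq_sqrt (show (0 : ℝ) ≤ 3 by norm_num)
  ext i
  fin_cases i <;> simp only [inner_R2, v1, v2, v3, PiLp.add_apply, PiLp.smul_apply, smul_eq_mul,
    Fin.zero_eta, Fin.mk_one, Matrix.cons_val]
  · linear_combination (-(x 0) / 3) * h3
  · ring

theorem inner_v1_add_inner_v2_add_inner_v3 (x : R2) :
    inner ℝ v1 x + inner ℝ v2 x + inner ℝ v3 x = 0 := by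
  rw [← inner_add_left, ← inner_add_left, v1_add_v2_add_v3, inner_zero_left]

theorem V_eq (x : R2) : V x = (1 - edge v1 x * edge v2 x * edge v3 x) / 6 := by
  simp only [V, edge, inner_R2, v1, v2, v3, Matrix.cons_val]
  linear_combination (-(1 + 2 * x 1) * x 0 ^ 2 / 6) * Real.sq_sqrt (show (0 : ℝ) ≤ 3 by norm_num)

theorem hasDerivAt_edge (v : R2) {x : ℝ → R2} {x' : R2} {t : ℝ} (hx : HasDerivAt x x' t) :
    HasDerivAt (fun s => edge v (x s)) (2 * inner ℝ v x') t := by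
  refine ((((hasDerivAt_const t v).inner ℝ hx).const_mul 2).const_add 1).congr_deriv ?_
  rw [inner_zero_left, add_zero]

theorem inner_gradient_V (x a : R2) : inner ℝ (gradient V x) a =
    -(inner ℝ v1 a * edge v2 x * edge v3 x + inner ℝ v2 a * edge v1 x * edge v3 x
      + inner ℝ v3 a * edge v1 x * edge v2 x) / 3 := by
  have hedge (v : R2) := hasDerivAt_edge v (hasDerivAt_line x a)
  rw [inner_gradient_left, ← (contDiff_V.differentiable one_ne_zero x).lineDeriv_eq_fderiv]
  refine HasLineDerivAt.lineDeriv ?_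
  simp only [HasLineDerivAt, V_eq]
  refine (((((hedge v1).mul (hedge v2)).mul (hedge v3)).const_sub 1).div_const 6).congr_deriv ?_
  simp only [zero_smul, add_zero, Pi.mul_apply]
  ring

theorem inner_fderiv_gradient_V (x a : R2) : inner ℝ (fderiv ℝ (gradient V) x a) a =
    -4 * (inner ℝ v1 a * inner ℝ v2 a * edge v3 x + inner ℝ v1 a * inner ℝ v3 a * edge v2 x
      + inner ℝ v2 a * inner ℝ v3 a * edge v1 x) / 3 := by
  have hedge (v : R2) := hasDerivAt_edge v (hasDerivAt_line x a)
  have hgrad := (differentiable_gradient contDiff_V x).hasFDerivAt.hasLineDerivAt a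
  have hinner := HasDerivAt.inner ℝ hgrad (hasDerivAt_const 0 a)
  simp only [inner_gradient_V, inner_zero_right, zero_add] at hinner
  rw [hinner.unique ((((((hedge v2).const_mul _).mul (hedge v3)).add
    (((hedge v1).const_mul _).mul (hedge v3))).add
    (((hedge v1).const_mul _).mul (hedge v2))).neg.div_const 3)]
  simp only [zero_smul, add_zero]
  ring

theorem convex_form_pos {p q r a b c : ℝ} (hp : 0 < p) (hq : 0 < q) (hr : 0 < r)
    (habc : a + b + c = 0) (hab : a ≠ 0 ∨ b ≠ 0) :
    0 < (a * q * r + b * p * r + c * p * q) ^ 2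
      - 4 * (p * q * r) * (a * b * r + a * c * q + b * c * p) := by
  obtain rfl : c = -(a + b) := by linarith
  set X := a * q * (p + r)
  set Y := b * p * (q + r)
  have hXY : X + Y ≠ 0 ∨ X - Y ≠ 0 := by
    by_contra! h
    have hX : X = 0 := by linarith
    have hY : Y = 0 := by linarith
    rcases hab with ha | hb
    · exact mul_ne_zero (mul_ne_zero ha hq.ne') (add_pos hp hr).ne' hX
    · exact mul_ne_zero (mul_ne_zero hb hp.ne') (add_pos hq hr).ne' hY
  refine pos_of_mul_pos_right (?_ : 0 < (p + r) * (q + r) * _) (by positivity)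
  calc 0 < (p * q + p * r + q * r) * (X + Y) ^ 2 + r ^ 2 * (X - Y) ^ 2 := by
        rcases hXY with h | h <;> positivity
    _ = _ := by ring

theorem convex_form_eq_zero_of_boundary {p q r a b c : ℝ} (hpqr : p * q * r = 0)
    (hne : ¬(q * r = 0 ∧ p * r = 0 ∧ p * q = 0)) (h : a * q * r + b * p * r + c * p * q = 0) :
    a * b * r + a * c * q + b * c * p = 0 := by
  grind

theorem edge_add_edge_add_edge (x : R2) : edge v1 x + edge v2 x + edge v3 x = 3 := by
  simp only [edge]
  linear_combination 2 * inner_v1_add_inner_v2_add_inner_v3 x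

theorem mem_vertices_of_edge_mul_eq_zero {x : R2} (h₁ : edge v2 x * edge v3 x = 0)
    (h₂ : edge v1 x * edge v3 x = 0) (h₃ : edge v1 x * edge v2 x = 0) :
    x ∈ ({v1, v2, v3} : Set R2) := by
  have hsum := edge_add_edge_add_edge x
  have hx := eq_smul_sum_inner_smul x
  have hv : v3 = -(v1 + v2) := eq_neg_of_add_eq_zero_right v1_add_v2_add_v3
  obtain ⟨h, h'⟩ | ⟨h, h'⟩ | ⟨h, h'⟩ : edge v2 x = 0 ∧ edge v3 x = 0 ∨
      edge v1 x = 0 ∧ edge v3 x = 0 ∨ edge v1 x = 0 ∧ edge v2 x = 0 := by grind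
  all_goals
    simp only [edge] at h h' hsum
  · left
    rw [hx, show inner ℝ v1 x = 1 by linarith, show inner ℝ v2 x = -1 / 2 by linarith,
      show inner ℝ v3 x = -1 / 2 by linarith, hv]
    module
  · right; left
    rw [hx, show inner ℝ v1 x = -1 / 2 by linarith, show inner ℝ v2 x = 1 by linarith,
      show inner ℝ v3 x = -1 / 2 by linarith, hv]
    module
  · right; right
    rw [hx, show inner ℝ v1 x = -1 / 2 by linarith, show inner ℝ v2 x = -1 / 2 by linarith,
      show inner ℝ v3 x = 1 by linarith, mem_singleton_iff, hv]
    module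

theorem three_mul_norm_mom_sq {w : R4} (hw : H w = 1 / 6) :
    3 * ‖mom w‖ ^ 2 = edge v1 (proj w) * edge v2 (proj w) * edge v3 (proj w) := by
  rw [H_eq_mechanical, mechanical, V_eq] at hw
  linarith

theorem eq_lift_of_mom_eq_zero {w : R4} (hw : mom w = 0) : w = lift (proj w) := by
  have h₂ : w 2 = 0 := congr_fun (congr_arg WithLp.ofLp hw) 0
  have h₃ : w 3 = 0 := congr_fun (congr_arg WithLp.ofLp hw) 1
  ext i
  fin_cases i <;> simp [lift, proj, h₂, h₃]

theorem gradient_V_ne_zero {x : R2} (hx : edge v1 x * edge v2 x * edge v3 x = 0)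
    (hvert : x ∉ ({v1, v2, v3} : Set R2)) : gradient V x ≠ 0 := by
  intro hgrad
  have h (a : R2) := inner_gradient_V x a
  simp only [hgrad, inner_zero_left] at h
  have h₁ := h v1
  have h₂ := h v2
  rw [real_inner_comm v1 v2, real_inner_comm v1 v3, inner_v1_v1, inner_v1_v2, inner_v1_v3] at h₁
  rw [real_inner_comm v2 v3, inner_v2_v2, inner_v1_v2, inner_v2_v3] at h₂
  refine hvert (mem_vertices_of_edge_mul_eq_zero ?_ ?_ ?_) <;> grind

theorem convex_V {w : R4} (hw : w ∈ S) (hmom : mom w ≠ 0) {a : R2} (ha : a ≠ 0) :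
    0 < ‖mom w‖ ^ 2 * inner ℝ (fderiv ℝ (gradient V) (proj w) a) a
      + inner ℝ (gradient V (proj w)) a ^ 2 := by
  have henergy := three_mul_norm_mom_sq hw.1
  have hprod : 0 < edge v1 (proj w) * edge v2 (proj w) * edge v3 (proj w) := by
    rw [← henergy]; positivity
  have hedge {v : R2} (hv : v ∈ ({v1, v2, v3} : Set R2)) := edge_nonneg_of_mem_K hv hw.2
  have hp := (hedge (.inl rfl)).lt_of_ne' (left_ne_zero_of_mul (left_ne_zero_of_mul hprod.ne'))
  have hq := (hedge (.inr (.inl rfl))).lt_of_ne'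
    (right_ne_zero_of_mul (left_ne_zero_of_mul hprod.ne'))
  have hr := (hedge (.inr (.inr rfl))).lt_of_ne' (right_ne_zero_of_mul hprod.ne')
  have hsum := inner_v1_add_inner_v2_add_inner_v3 a
  have hne : inner ℝ v1 a ≠ 0 ∨ inner ℝ v2 a ≠ 0 := by
    by_contra! h
    refine ha ?_
    rw [eq_smul_sum_inner_smul a, h.1, h.2, show inner ℝ v3 a = 0 by linarith [h.1, h.2]]
    module
  have hform := convex_form_pos hp hq hr hsum hne
  rw [inner_gradient_V, inner_fderiv_gradient_V, ← mul_div_cancel_left₀ (‖mom w‖ ^ 2) three_ne_zero,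
    henergy]
  linear_combination hform / 9

theorem convexAt_V {w : R4} (hw : w ∈ S \ saddleCenters) : ConvexAt V w := by
  obtain ⟨hS, hsaddle⟩ := hw
  have hbrake (hmom : mom w = 0) :
      edge v1 (proj w) * edge v2 (proj w) * edge v3 (proj w) = 0 ∧
        proj w ∉ ({v1, v2, v3} : Set R2) := by
    constructor
    · simpa [hmom] using (three_mul_norm_mom_sq hS.1).symm
    · rw [eq_lift_of_mom_eq_zero hmom] at hsaddle
      exact fun h => hsaddle <| by
        simpa only [saddleCenters, image_insert_eq, image_singleton] using mem_image_of_mem lift h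
  refine ⟨fun hmom => gradient_V_ne_zero (hbrake hmom).1 (hbrake hmom).2, fun hmom a ha => ?_,
    fun hmom a ha => convex_V hS hmom ha⟩
  obtain ⟨hprod, hvert⟩ := hbrake hmom
  rw [inner_gradient_V] at ha
  rw [inner_fderiv_gradient_V, mul_div_assoc, convex_form_eq_zero_of_boundary hprod
    (fun h => hvert (mem_vertices_of_edge_mul_eq_zero h.1 h.2.1 h.2.2)) (by linarith)]
  simp

end HenonHeiles

end

theorem mainTheorem4_general {U : HenonHeiles.R2 → ℝ} (hU : ContDiff ℝ 2 U)
    {S : Set HenonHeiles.R4} (hS : ∀ w ∈ S, HenonHeiles.ConvexAt U w) :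
    HenonHeiles.DynamicallyConvex (HenonHeiles.mechanical U) S ∧
      HenonHeiles.QuaternionFramePositive (HenonHeiles.mechanical U) S :=
  ⟨HenonHeiles.dynamicallyConvex_of_convexAt hU hS,
    HenonHeiles.quaternionFramePositive_of_convexAt hU hS⟩

theorem mainTheorem4 :
    HenonHeiles.DynamicallyConvex HenonHeiles.H (HenonHeiles.S \ HenonHeiles.saddleCenters) ∧
    HenonHeiles.QuaternionFramePositive HenonHeiles.H
      (HenonHeiles.S \ HenonHeiles.saddleCenters) := by
  rw [HenonHeiles.H_eq_mechanical]
  exact mainTheorem4_general HenonHeiles.contDiff_V fun _ => HenonHeiles.convexAt_V
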